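/- Fix integers $k\ge 3$ and $d\ge 2$ and a real constant $c>0$. A constraint on $k$ variables with domain $\{1,\dots,d\}$ (a set of permitted $k$-tuples of values) is *uniquely extendible* if for every assignment to any $k-1$ of its variables there is exactly one value of the remaining variable for which the constraint is satisfied. A $(k,d)$-UE-CSP instance with $n$ variables and $m$ clauses consists of $m$ clauses (ordered $k$-subsets of the $n$ variables) lying on $m$ different $k$-subsets of the variables, each with a uniquely extendible constraint. Let $U_n$ be uniformly random among the instances with $n$ variables and $m=\lfloor cn\rfloor$ clauses. For an instance $I$, $\mathrm{CNF}(I)$ has a boolean variable $x{:}a$ for each variable $x$ and value $a$, and the clauses $\bigvee_a x{:}a$ for each $x$; $\neg x{:}a\vee\neg x{:}b$ for each $x$ and $a\ne b$; and $\neg x_1{:}a_1\vee\dots\vee\neg x_k{:}a_k$ for each clause $(x_1,\dots,x_k)$ of $I$ and each tuple $(a_1,\dots,a_k)$ that its constraint forbids. $\mathrm{C\text{-}RES}(I)$ is the least number of clauses in a resolution derivation of the empty clause from $\mathrm{CNF}(I)$. $\mathrm{NG\text{-}RES}(I)$ is the least number of nogoods in a derivation of the empty nogood from the initial nogoods $\{x_1=a_1,\dots,x_k=a_k\}$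 (one for each forbidden tuple as above) by the rule: from $\{x=a\}\cup N_a$ (with $(x=a)\notin N_a$), one for each value $a$, infer $\bigcup_a N_a$. Both are $\infty$ if there is no such derivation; this is the case when $I$ is satisfiable. **Theorem.** For all constants $c>0$, $k\ge3$ and $d\ge2$, $\mathrm{C\text{-}RES}(U_n)$ is a.a.s. $2^{\Theta(n)}$, in the following sense: there are constants $\alpha,\beta>0$, depending only on $c,k,d$, such that with probability tending to $1$ as $n\to\infty$, $\mathrm{C\text{-}RES}(U_n)\ge 2^{\alpha n}$ and, if $U_n$ is unsatisfiable, also $\mathrm{C\text{-}RES}(U_n)\le 2^{\beta n}$. The same holds for $\mathrm{NG\text{-}RES}$. -/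

import Mathlib

open Filter Topology
open scoped ENNReal

/-! ### Proof systems and proof length -/

/-- `π 0, …, π (s - 1)` is a derivation from the axioms `ax`: every line is an axiom or follows
by the inference rule from earlier lines (`rule S x`: `x` is inferred in one step from members
of `S`). -/
def IsDerivation {α : Type*} (ax : Set α) (rule : Set α → α → Prop) {s : ℕ} (π : Fin s → α) :
    Prop :=
  ∀ i : Fin s, π i ∈ ax ∨ rule {x | ∃ j < i, π j = x} (π i)

/-- The least number of lines of a derivation of `goal`; it is `⊤` if there is none. -/
noncomputable def proofLength {α : Type*} (ax : Set α) (rule : Set α → α → Prop) (goal : α) :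
    ℕ∞ :=
  ⨅ (s : ℕ) (_ : ∃ π : Fin s → α, IsDerivation ax rule π ∧ ∃ i, π i = goal), (s : ℕ∞)

/-- A boolean clause over the variables `ν`, as a finite set of literals: `(v, true)` is the
literal `v` and `(v, false)` is the literal `¬ v`. -/
abbrev BoolClause (ν : Type*) := Finset (ν × Bool)

/-- The resolution rule: from `A ∨ v` and `B ∨ ¬ v` infer `A ∨ B`. -/
def ResolutionRule {ν : Type*} [DecidableEq ν] (S : Set (BoolClause ν)) (E : BoolClause ν) :
    Prop :=
  ∃ C ∈ S, ∃ D ∈ S, ∃ v : ν, (v, true) ∈ C ∧ (v, false) ∈ D ∧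
    E = C.erase (v, true) ∪ D.erase (v, false)

/-- The resolution complexity of a CNF formula: the length of a shortest resolution derivation of
the empty clause. -/
noncomputable def resolutionComplexity {ν : Type*} [DecidableEq ν] (F : Set (BoolClause ν)) :
    ℕ∞ :=
  proofLength F ResolutionRule ∅

/-! ### Uniquely extendible constraint satisfaction problems -/

/-- A constraint on `k` variables with domain `Fin d`, given by the tuples that it permits, is
uniquely extendible: for every assignment to any `k - 1` of the variables exactly one value of the
remaining variable `i` satisfies the constraint. (The value `t i` plays no role.) -/
def UniquelyExtendible {k d : ℕ} (R : Finset (Fin k → Fin d)) : Prop :=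
  ∀ (i : Fin k) (t : Fin k → Fin d), ∃! a : Fin d, Function.update t i a ∈ R

/-- A finite set of clauses of size `k` on `n` variables with domain `Fin d`, each with its
constraint. A clause is an ordered `k`-subset `e` of the variables; the constraint is the set of
the permitted tuples of values of `e 0, …, e (k - 1)`. -/
abbrev CSPInstance (n k d : ℕ) := Finset ((Fin k ↪ Fin n) × Finset (Fin k → Fin d))

namespace CSPInstance

variable {n k d : ℕ}

/-- Some assignment of values to the variables satisfies every constraint. -/
def Satisfiable (I : CSPInstance n k d) : Prop :=
  ∃ σ : Fin n → Fin d, ∀ p ∈ I, (fun i => σ (p.1 i)) ∈ p.2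

/-- The boolean CNF formula of a CSP instance. The boolean variable `(x, a)` says that `x` takes
the value `a`. There is a domain clause for each variable, a unique-value clause for each variable
and each pair of distinct values, and a conflict clause for each tuple that a constraint
forbids. -/
def cnf (I : CSPInstance n k d) : Set (BoolClause (Fin n × Fin d)) :=
  {C | (∃ x : Fin n, C = Finset.univ.image fun a : Fin d => ((x, a), true)) ∨
    (∃ (x : Fin n) (a b : Fin d), a ≠ b ∧ C = {((x, a), false), ((x, b), false)}) ∨
    (∃ p ∈ I, ∃ t : Fin k → Fin d, t ∉ p.2 ∧
      C = Finset.univ.image fun i : Fin k => ((p.1 i, t i), false))}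

/-- The C-RES complexity: the resolution complexity of the CNF formula of the instance. -/
noncomputable def cRes (I : CSPInstance n k d) : ℕ∞ := resolutionComplexity I.cnf

/-- The initial nogoods, one for each tuple that a constraint forbids. A nogood is a finite set of
pairs `(x, a)` and says that not all the assignments `x = a` in it can hold together. -/
def nogoods (I : CSPInstance n k d) : Set (Finset (Fin n × Fin d)) :=
  {N | ∃ p ∈ I, ∃ t : Fin k → Fin d, t ∉ p.2 ∧
    N = Finset.univ.image fun i : Fin k => (p.1 i, t i)}

end CSPInstance

/-- The nogood resolution rule: from nogoods `{x = a} ∪ M a`, one for each value `a` in the domain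
of `x`, infer the nogood `⋃ a, M a`. -/
def NogoodRule {n d : ℕ} (S : Set (Finset (Fin n × Fin d))) (M : Finset (Fin n × Fin d)) : Prop :=
  ∃ (x : Fin n) (N : Fin d → Finset (Fin n × Fin d)), (∀ a, N a ∈ S ∧ (x, a) ∈ N a) ∧
    M = Finset.univ.biUnion fun a => (N a).erase (x, a)

/-- The NG-RES complexity: the length of a shortest nogood resolution derivation of the empty
nogood. -/
noncomputable def CSPInstance.ngRes {n k d : ℕ} (I : CSPInstance n k d) : ℕ∞ :=
  proofLength I.nogoods NogoodRule ∅

/-! ### The random model -/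

open Classical in
/-- The set of the `(k,d)`-UE-CSP instances on `n` variables with `m` clauses: the clauses lie on
`m` different `k`-subsets of the variables (the hyperedges of the underlying hypergraph), and each
carries a uniquely extendible constraint. -/
noncomputable def ueCSP (n m k d : ℕ) : Finset (CSPInstance n k d) :=
  Finset.univ.filter fun I =>
    I.card = m ∧ (∀ p ∈ I, UniquelyExtendible p.2) ∧
      ∀ p ∈ I, ∀ q ∈ I, Set.range p.1 = Set.range q.1 → p = q

open Classical in
/-- The probability of the event `P` for a uniformly random element of the finite set `Ω`. -/
noncomputable def uniformProb {α : Type*} (Ω : Finset α) (P : α → Prop) : ℝ :=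
  ((Ω.filter P).card : ℝ) / (Ω.card : ℝ)

/-- The complexity measure `μ` is a.a.s. `2^Θ(n)` on a uniformly random `(k,d)`-UE-CSP instance
with `n` variables and `⌊c n⌋` clauses: for some constants `α, β > 0`, with probability tending to
`1`, it is at least `2 ^ (α n)` and, if the instance is unsatisfiable, at most `2 ^ (β n)`. -/
def IsAASExponential (μ : ∀ {n k d : ℕ}, CSPInstance n k d → ℕ∞) (c : ℝ) (k d : ℕ) : Prop :=
  ∃ α β : ℝ, 0 < α ∧ 0 < β ∧
    Tendsto
      (fun n : ℕ => uniformProb (ueCSP n ⌊c * n⌋₊ k d) fun I =>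
        (2 : ℝ≥0∞) ^ (α * n) ≤ (μ I : ℝ≥0∞) ∧
          (¬ I.Satisfiable → (μ I : ℝ≥0∞) ≤ (2 : ℝ≥0∞) ^ (β * n)))
      atTop (𝓝 1)

/-!
Upper bound. If the instance is unsatisfiable, branching over the variables one after the other
shows that every set of nogoods that contains the initial ones and is closed under nogood
resolution contains `∅`, and resolution simulates nogood resolution with the domain clauses. There
are only `2 ^ (n * d)` nogoods and `2 ^ (2 * n * d)` boolean clauses, and a shortest derivation
need not repeat a line (`CSPInstance.ngRes_le`, `CSPInstance.cRes_le`).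

Lower bound. With probability tending to `1` every set of `t ≤ δ n` clauses contains at least `(2k + 1) t / 4`
variables (`exists_tendsto_not_isExpanding`). This is a union bound over dense sets of clauses: an
exchange argument bounds the probability that all clauses of a given set are present, and
`(2k + 1) / 4 < k - 1` makes the sum vanish. As `(2k + 1) / 4 > k / 2`, a positive proportion of
the variables of such a set of clauses occurs in only one of them. By unique extendibility a
minimal set of clauses that contradicts a partial assignment `ρ` has all these boundary variables
in `ρ` (`CSPInstance.card_boundary_le`), so `ρ` must be large if the set is. Hence in the game
where a prover queries boolean variables and keeps at most `γ n` answers in memory, an adversary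
can keep all sets of at most `s` clauses satisfiable together with these answers
(`CSPInstance.IsExpanding.isStrategy`): if both answers to a query failed, then the union of the
two contradictory sets of clauses would have size at most `2 s` and contradict the old answers.

Such a strategy rules out derivations all of whose lines are narrow, in both proof systems, as a
prover could walk from the empty clause towards the axioms. The size–width argument of Ben-Sasson
and Wigderson, carried out on strategies rather than on proofs, then rules out subexponential
derivations (`IsStrategy.one_le_mul_pow`).
-/

/-! ### Exhaustive derivations and completeness -/

/-- Over a finite type of lines some derivation without repetitions cannot be prolonged: its lines
contain the axioms and are closed under the inference rule. -/
lemma exists_saturated_derivation {α : Type*} [Fintype α] (ax : Set α)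
    (rule : Set α → α → Prop) :
    ∃ (s : ℕ) (π : Fin s → α), s ≤ Fintype.card α ∧ IsDerivation ax rule π ∧
      ax ⊆ Set.range π ∧ ∀ x, rule (Set.range π) x → x ∈ Set.range π := by
  classical
  let P : ℕ → Prop := fun s => ∃ π : Fin s → α, Function.Injective π ∧ IsDerivation ax rule π
  have hbound : ∀ s, P s → s ≤ Fintype.card α := by
    rintro s ⟨π, hπ, -⟩
    simpa using Fintype.card_le_of_injective π hπ
  have h0 : P 0 := ⟨Fin.elim0, fun i => i.elim0, fun i => i.elim0⟩
  obtain ⟨π, hinj, hder⟩ : P (Nat.findGreatest P (Fintype.card α)) :=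
    Nat.findGreatest_spec (Nat.zero_le _) h0
  have key : ∀ x, (x ∈ ax ∨ rule (Set.range π) x) → x ∈ Set.range π := by
    intro x hx
    by_contra hxr
    have hP : P (Nat.findGreatest P (Fintype.card α) + 1) := by
      refine ⟨Fin.snoc (α := fun _ => α) π x, Fin.snoc_injective_of_injective hinj hxr, ?_⟩
      intro i
      refine Fin.lastCases ?_ (fun i => ?_) i
      · have : {y | ∃ j < Fin.last _, Fin.snoc (α := fun _ => α) π x j = y} = Set.range π := by
          ext y
          constructor
          · rintro ⟨j, hj, rfl⟩
            refine ⟨j.castLT (by simpa [Fin.lt_def] using hj), ?_⟩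
            rw [← Fin.snoc_castSucc (α := fun _ => α) x π]
            simp
          · rintro ⟨j, rfl⟩
            exact ⟨j.castSucc, Fin.castSucc_lt_last j, by simp⟩
        rw [this]
        simpa using hx
      · have : {y | ∃ j < i.castSucc, Fin.snoc (α := fun _ => α) π x j = y} =
            {y | ∃ j < i, π j = y} := by
          ext y
          constructor
          · rintro ⟨j, hj, rfl⟩
            refine ⟨j.castLT (hj.trans (Fin.castSucc_lt_last i)), ?_, ?_⟩
            · simpa [Fin.lt_def] using hj
            · rw [← Fin.snoc_castSucc (α := fun _ => α) x π]
              simp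
          · rintro ⟨j, hj, rfl⟩
            exact ⟨j.castSucc, by simpa using hj, by simp⟩
        rw [this]
        simpa using hder i
    have := Nat.le_findGreatest (hbound _ hP) hP
    omega
  exact ⟨_, π, Nat.findGreatest_le _, hder, fun x hx => key x (Or.inl hx),
    fun x hx => key x (Or.inr hx)⟩

/-- If every set of lines that contains the axioms and is closed under the rule contains the goal,
then the goal has a derivation with at most as many lines as there are possible lines. -/
lemma proofLength_le_card {α : Type*} [Fintype α] {ax : Set α}
    {rule : Set α → α → Prop} {goal : α}
    (h : ∀ T : Set α, ax ⊆ T → (∀ x, rule T x → x ∈ T) → goal ∈ T) :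
    proofLength ax rule goal ≤ (Fintype.card α : ℕ) := by
  obtain ⟨s, π, hs, hder, hax, hcl⟩ := exists_saturated_derivation ax rule
  obtain ⟨i, hi⟩ := h _ hax hcl
  exact (iInf₂_le s ⟨π, hder, i, hi⟩).trans (by exact_mod_cast hs)

namespace CSPInstance

variable {n k d : ℕ}

/-- Completeness of nogood resolution. Branching on the variables one after the other, one finds
for every assignment of the first `j` variables a nogood in `T` that is contained in it. -/
lemma empty_mem_of_nogood_closed {I : CSPInstance n k d} (hI : ¬ I.Satisfiable)
    {T : Set (Finset (Fin n × Fin d))} (hax : I.nogoods ⊆ T)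
    (hcl : ∀ M, NogoodRule T M → M ∈ T) : ∅ ∈ T := by
  have key : ∀ j ≤ n, ∀ σ : Fin n → Fin d,
      ∃ N ∈ T, ∀ y ∈ N, y.2 = σ y.1 ∧ (y.1 : ℕ) < j := by
    intro j hj
    induction hj using Nat.decreasingInduction with
    | self =>
      intro σ
      have : ∃ p ∈ I, (fun i => σ (p.1 i)) ∉ p.2 := by
        by_contra hcon
        push Not at hcon
        exact hI ⟨σ, hcon⟩
      obtain ⟨p, hp, hσ⟩ := this
      refine ⟨_, hax ⟨p, hp, _, hσ, rfl⟩, ?_⟩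
      intro y hy
      obtain ⟨i, -, rfl⟩ := Finset.mem_image.1 hy
      exact ⟨rfl, (p.1 i).2⟩
    | of_succ j hj ih =>
      intro σ
      choose N hNT hN using fun a : Fin d => ih (Function.update σ ⟨j, hj⟩ a)
      by_cases hall : ∀ a, ((⟨j, hj⟩, a) : Fin n × Fin d) ∈ N a
      · refine ⟨_, hcl _ ⟨⟨j, hj⟩, N, fun a => ⟨hNT a, hall a⟩, rfl⟩, ?_⟩
        intro y hy
        obtain ⟨a, -, hya⟩ := Finset.mem_biUnion.1 hy
        obtain ⟨hne, hya⟩ := Finset.mem_erase.1 hya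
        obtain ⟨h1, h2⟩ := hN a y hya
        have hy1 : y.1 ≠ ⟨j, hj⟩ := by
          intro h
          apply hne
          ext1
          · exact h
          · rw [h1, h]; simp
        refine ⟨by rw [h1, Function.update_of_ne hy1], ?_⟩
        have : (y.1 : ℕ) ≠ j := fun h => hy1 (Fin.ext h)
        omega
      · push Not at hall
        obtain ⟨a, ha⟩ := hall
        refine ⟨N a, hNT a, fun y hy => ?_⟩
        obtain ⟨h1, h2⟩ := hN a y hy
        have hy1 : y.1 ≠ ⟨j, hj⟩ := by
          intro h
          apply ha
          have : y = (⟨j, hj⟩, a) := by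
            ext1
            · exact h
            · rw [h1, h]; simp
          rwa [← this]
        refine ⟨by rw [h1, Function.update_of_ne hy1], ?_⟩
        have : (y.1 : ℕ) ≠ j := fun h => hy1 (Fin.ext h)
        omega
  rcases Nat.eq_zero_or_pos d with rfl | hd
  · -- With an empty domain the rule infers `∅` from nothing, unless there are no variables.
    rcases Nat.eq_zero_or_pos n with rfl | hn
    · obtain ⟨N, hN, hN'⟩ := key 0 le_rfl (fun x => x.elim0)
      have : N = ∅ := Finset.eq_empty_of_forall_notMem fun y _ => y.1.elim0
      rwa [← this]
    · exact hcl _ ⟨⟨0, hn⟩, fun a => a.elim0, fun a => a.elim0, by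
        ext y; exact y.2.elim0⟩
  · obtain ⟨N, hN, hN'⟩ := key 0 (Nat.zero_le n) (fun _ => ⟨0, hd⟩)
    have : N = ∅ := Finset.eq_empty_of_forall_notMem fun y hy => by
      have := (hN' y hy).2
      omega
    rwa [← this]

end CSPInstance

/-- The clause that a nogood stands for: at least one of its assignments fails. -/
def negClause {ν : Type*} [DecidableEq ν] (N : Finset ν) : BoolClause ν :=
  N.image fun v => (v, false)

lemma mem_negClause {ν : Type*} [DecidableEq ν] {N : Finset ν} {l : ν × Bool} :
    l ∈ negClause N ↔ l.1 ∈ N ∧ l.2 = false := by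
  obtain ⟨v, b⟩ := l
  simp [negClause, eq_comm]

namespace CSPInstance

variable {n k d : ℕ}

/-- Resolution simulates the nogood rule: the domain clause of `x` is resolved with the clauses
`negClause (N a)` for all values `a`, one after the other. -/
lemma negClause_mem_of_nogoodRule {I : CSPInstance n k d}
    {T : Set (BoolClause (Fin n × Fin d))} (hax : I.cnf ⊆ T)
    (hcl : ∀ C, ResolutionRule T C → C ∈ T) {M : Finset (Fin n × Fin d)}
    (hM : NogoodRule {N | negClause N ∈ T} M) : negClause M ∈ T := by
  obtain ⟨x, N, hN, rfl⟩ := hM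
  have key : ∀ A : Finset (Fin d),
      (Finset.univ \ A).image (fun a : Fin d => ((x, a), true)) ∪
        A.biUnion (fun a => negClause ((N a).erase (x, a))) ∈ T := by
    intro A
    induction A using Finset.induction_on with
    | empty => simpa using hax (Or.inl ⟨x, rfl⟩)
    | insert b A hb ih =>
      refine hcl _ ⟨_, ih, _, (hN b).1, (x, b), ?_, ?_, ?_⟩
      · simp [hb]
      · simpa [mem_negClause] using (hN b).2
      · ext ⟨⟨y, a⟩, e⟩
        simp only [Finset.mem_union, Finset.mem_image, Finset.mem_sdiff, Finset.mem_univ,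
          Finset.mem_insert, Finset.mem_biUnion, Finset.mem_erase, mem_negClause]
        cases e <;> grind
  have := key Finset.univ
  convert this using 1
  ext l
  simp only [mem_negClause, Finset.mem_union, Finset.mem_biUnion]
  simp

lemma nogoods_subset_of_cnf_subset {I : CSPInstance n k d}
    {T : Set (BoolClause (Fin n × Fin d))} (hax : I.cnf ⊆ T) :
    I.nogoods ⊆ {N | negClause N ∈ T} := by
  rintro N ⟨p, hp, t, ht, rfl⟩
  refine hax (Or.inr (Or.inr ⟨p, hp, t, ht, ?_⟩))
  rw [negClause, Finset.image_image]
  rfl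

lemma ngRes_le {I : CSPInstance n k d} (hI : ¬ I.Satisfiable) :
    I.ngRes ≤ (2 ^ (n * d) : ℕ) := by
  have := proofLength_le_card (ax := I.nogoods) (rule := NogoodRule) (goal := ∅)
    fun T hax hcl => empty_mem_of_nogood_closed hI hax hcl
  simpa [ngRes] using this

lemma cRes_le {I : CSPInstance n k d} (hI : ¬ I.Satisfiable) :
    I.cRes ≤ (2 ^ (n * d * 2) : ℕ) := by
  have := proofLength_le_card (ax := I.cnf) (rule := ResolutionRule) (goal := ∅)
    fun T hax hcl => by
      have h := empty_mem_of_nogood_closed hI (nogoods_subset_of_cnf_subset hax)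
        fun M hM => negClause_mem_of_nogoodRule hax hcl hM
      simpa [negClause] using h
  simpa [cRes, resolutionComplexity] using this

end CSPInstance

/-! ### Size lower bounds from winning strategies -/

section SizeWidth

variable {ν : Type*}

/-- The complementary literal. -/
def negLit (l : ν × Bool) : ν × Bool := (l.1, !l.2)

@[simp] lemma negLit_negLit (l : ν × Bool) : negLit (negLit l) = l := by
  simp [negLit]

lemma negLit_ne (l : ν × Bool) : negLit l ≠ l := by
  obtain ⟨v, b⟩ := l
  simp [negLit]

/-- The partial assignment `ρ`, given by the literals that it makes true, falsifies every literal
of the clause `C`. -/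
def Falsifies (ρ : Finset (ν × Bool)) (C : BoolClause ν) : Prop :=
  ∀ l ∈ C, negLit l ∈ ρ

/-- No literal is true together with its complement. -/
def IsConsistent (ρ : Finset (ν × Bool)) : Prop := ∀ l ∈ ρ, negLit l ∉ ρ

variable [DecidableEq ν]

/-- `H` is a winning strategy for the adversary in the game where a prover queries variables one
by one, starting from the partial assignment `τ`, and may keep `W` answers in memory in addition
to `τ`: positions in `H` can be shrunk down to `τ`, every query has an answer that stays in `H` as
long as fewer than `W` answers are in memory, and no position in `H` falsifies a clause of `F`. -/
structure IsStrategy (F : Set (BoolClause ν)) (τ : Finset (ν × Bool)) (W : ℕ)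
    (H : Set (Finset (ν × Bool))) : Prop where
  start : τ ∈ H
  sub : ∀ ρ ∈ H, τ ⊆ ρ
  cons : ∀ ρ ∈ H, IsConsistent ρ
  down : ∀ ρ ∈ H, ∀ ρ', τ ⊆ ρ' → ρ' ⊆ ρ → ρ' ∈ H
  answer : ∀ ρ ∈ H, ρ.card < τ.card + W → ∀ v, ∃ b, insert (v, b) ρ ∈ H
  ax : ∀ ρ ∈ H, ∀ C ∈ F, ¬ Falsifies ρ C

/-- The clause `E` follows from the clauses in `S` by querying at most `q` variables: a partial
assignment that falsifies `E` and assigns these variables falsifies some clause in `S`. -/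
def QueryStep (q : ℕ) (S : Set (BoolClause ν)) (E : BoolClause ν) : Prop :=
  ∃ Q : Finset ν, Q.card ≤ q ∧ ∀ ρ, IsConsistent ρ → Falsifies ρ E →
    (∀ v ∈ Q, ∃ b, (v, b) ∈ ρ) → ∃ C ∈ S, Falsifies ρ C

/-- The literals of `C` that `τ` leaves unfalsified. -/
def unfalsified (τ : Finset (ν × Bool)) (C : BoolClause ν) : BoolClause ν :=
  C.filter fun l => negLit l ∉ τ

namespace IsStrategy

variable {F : Set (BoolClause ν)} {τ : Finset (ν × Bool)} {W : ℕ}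
  {H : Set (Finset (ν × Bool))}

lemma answer_all (h : IsStrategy F τ W H) (Q : Finset ν) :
    ∀ ρ ∈ H, ρ.card + Q.card ≤ τ.card + W →
      ∃ ρ' ∈ H, ρ ⊆ ρ' ∧ ∀ v ∈ Q, ∃ b, (v, b) ∈ ρ' := by
  induction Q using Finset.induction_on with
  | empty => exact fun ρ hρ _ => ⟨ρ, hρ, subset_rfl, by simp⟩
  | insert v Q hv ih =>
    intro ρ hρ hcard
    rw [Finset.card_insert_of_notMem hv] at hcard
    obtain ⟨b, hb⟩ := h.answer ρ hρ (by omega) v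
    have := Finset.card_insert_le (v, b) ρ
    obtain ⟨ρ', hρ', hsub, hQ⟩ := ih _ hb (by omega)
    refine ⟨ρ', hρ', (Finset.subset_insert _ _).trans hsub, fun w hw => ?_⟩
    rcases Finset.mem_insert.1 hw with rfl | hw
    · exact ⟨b, hsub (Finset.mem_insert_self _ _)⟩
    · exact hQ w hw

/-- The part of a position that is needed to falsify `C` is again a position, and its size beyond
`τ` is the number of literals of `C` that `τ` leaves unfalsified. -/
lemma exists_small (h : IsStrategy F τ W H) {ρ : Finset (ν × Bool)} (hρ : ρ ∈ H)
    {C : BoolClause ν} (hC : Falsifies ρ C) :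
    ∃ ρ' ∈ H, Falsifies ρ' C ∧ ρ'.card ≤ τ.card + (unfalsified τ C).card := by
  refine ⟨τ ∪ (unfalsified τ C).image negLit, ?_, ?_, ?_⟩
  · refine h.down ρ hρ _ Finset.subset_union_left (Finset.union_subset (h.sub ρ hρ) ?_)
    intro l hl
    obtain ⟨m, hm, rfl⟩ := Finset.mem_image.1 hl
    exact hC m (Finset.mem_filter.1 hm).1
  · intro l hl
    by_cases hlτ : negLit l ∈ τ
    · exact Finset.mem_union_left _ hlτ
    · exact Finset.mem_union_right _
        (Finset.mem_image_of_mem _ (Finset.mem_filter.2 ⟨hl, hlτ⟩))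
  · exact (Finset.card_union_le _ _).trans
      (Nat.add_le_add_left Finset.card_image_le _)

/-- A prover who walks down a derivation in which every clause that the adversary may reach is
narrow wins against every strategy: no line of the derivation can be falsified. -/
lemma not_falsifies (h : IsStrategy F τ W H) {q s D : ℕ} (hW : D + q ≤ W)
    {L : Fin s → BoolClause ν}
    (hL : ∀ i, QueryStep q (F ∪ {C | ∃ j < i, L j = C}) (L i))
    (hnarrow : ∀ i, ∀ ρ ∈ H, Falsifies ρ (L i) → (unfalsified τ (L i)).card ≤ D) :
    ∀ i, ∀ ρ ∈ H, ¬ Falsifies ρ (L i) := by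
  intro i
  induction i using WellFoundedLT.induction with
  | ind i ih =>
    intro ρ hρ hfal
    obtain ⟨Q, hQ, hstep⟩ := hL i
    obtain ⟨ρ₁, hρ₁, hfal₁, hcard⟩ := h.exists_small hρ hfal
    have := hnarrow i ρ hρ hfal
    obtain ⟨ρ₂, hρ₂, hsub, hQ₂⟩ := h.answer_all Q ρ₁ hρ₁ (by omega)
    obtain ⟨C, hC, hCfal⟩ := hstep ρ₂ (h.cons _ hρ₂) (fun l hl => hsub (hfal₁ l hl)) hQ₂
    rcases hC with hC | ⟨j, hj, rfl⟩
    · exact h.ax _ hρ₂ C hC hCfal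
    · exact ih j hj _ hρ₂ hCfal

/-- Pinning a literal that the adversary may concede costs one unit of memory. -/
lemma pin_true (h : IsStrategy F τ (W + 1) H) {l : ν × Bool} (hl : l ∉ τ)
    (hlH : insert l τ ∈ H) : IsStrategy F (insert l τ) W {ρ ∈ H | l ∈ ρ} where
  start := ⟨hlH, Finset.mem_insert_self _ _⟩
  sub ρ hρ := Finset.insert_subset hρ.2 (h.sub ρ hρ.1)
  cons ρ hρ := h.cons ρ hρ.1
  down ρ hρ ρ' h1 h2 := ⟨h.down ρ hρ.1 ρ' ((Finset.subset_insert _ _).trans h1) h2,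
    h1 (Finset.mem_insert_self _ _)⟩
  answer ρ hρ hcard v := by
    rw [Finset.card_insert_of_notMem hl] at hcard
    obtain ⟨b, hb⟩ := h.answer ρ hρ.1 (by omega) v
    exact ⟨b, hb, Finset.mem_insert_of_mem hρ.2⟩
  ax ρ hρ := h.ax ρ hρ.1

/-- Pinning the complement of a literal that the adversary never concedes is free: the prover may
forget this answer, as repeating the query brings it back. -/
lemma pin_false (h : IsStrategy F τ W H) {K : ℕ} (hF : ∀ C ∈ F, C.card ≤ K) (hKW : K < W)
    {l : ν × Bool} (hl' : negLit l ∉ τ) (hlH : insert l τ ∉ H) :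
    IsStrategy F (insert (negLit l) τ) W
      {ρ | negLit l ∈ ρ ∧ ρ.erase (negLit l) ∈ H} := by
  have hnot : ∀ ρ ∈ H, l ∉ ρ := fun ρ hρ hlρ =>
    hlH (h.down ρ hρ _ (Finset.subset_insert _ _) (Finset.insert_subset hlρ (h.sub ρ hρ)))
  have hans : ∀ ρ ∈ H, ρ.card < τ.card + W → insert (negLit l) ρ ∈ H := by
    intro ρ hρ hcard
    obtain ⟨b, hb⟩ := h.answer ρ hρ hcard l.1
    by_cases hbl : b = l.2
    · exact absurd (Finset.mem_insert_self _ _) (hbl ▸ hnot _ hb)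
    · have : b = !l.2 := by
        cases b <;> cases hl2 : l.2 <;> simp_all
      rwa [this] at hb
  have hne := negLit_ne l
  refine ⟨⟨Finset.mem_insert_self _ _, ?_⟩, ?_, ?_, ?_, ?_, ?_⟩
  · rw [Finset.erase_insert hl']
    exact h.start
  · rintro ρ ⟨h1, h2⟩
    exact Finset.insert_subset h1 ((h.sub _ h2).trans (Finset.erase_subset _ _))
  · rintro ρ ⟨h1, h2⟩ m hm hm'
    have hlρ : l ∉ ρ := fun hlρ => hnot _ h2 (Finset.mem_erase.2 ⟨hne.symm, hlρ⟩)
    by_cases hml : m = negLit l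
    · subst hml
      rw [negLit_negLit] at hm'
      exact hlρ hm'
    · by_cases hml' : negLit m = negLit l
      · apply hlρ
        rw [← negLit_negLit l, ← hml', negLit_negLit]
        exact hm
      · exact h.cons _ h2 m (Finset.mem_erase.2 ⟨hml, hm⟩) (Finset.mem_erase.2 ⟨hml', hm'⟩)
  · rintro ρ ⟨h1, h2⟩ ρ' hsub hsub'
    refine ⟨hsub (Finset.mem_insert_self _ _), h.down _ h2 _ ?_
      (Finset.erase_subset_erase _ hsub')⟩
    intro m hm
    exact Finset.mem_erase.2 ⟨fun hml => hl' (hml ▸ hm), hsub (Finset.mem_insert_of_mem hm)⟩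
  · rintro ρ ⟨h1, h2⟩ hcard v
    rw [Finset.card_insert_of_notMem hl'] at hcard
    have hc := Finset.card_erase_add_one h1
    obtain ⟨b, hb⟩ := h.answer _ h2 (by omega) v
    refine ⟨b, Finset.mem_insert_of_mem h1, h.down _ hb _ ?_ ?_⟩
    · intro m hm
      exact Finset.mem_erase.2 ⟨fun hml => hl' (hml ▸ hm),
        Finset.mem_insert_of_mem (Finset.mem_of_mem_erase (h.sub _ h2 hm))⟩
    · intro m hm
      simp only [Finset.mem_erase, Finset.mem_insert] at hm ⊢
      tauto
  · rintro ρ ⟨h1, h2⟩ C hC hfal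
    -- Only the at most `K` answers that falsify the rest of `C` are kept before asking again.
    have hfal' : Falsifies (ρ.erase (negLit l)) (C.erase l) := by
      intro m hm
      refine Finset.mem_erase.2 ⟨fun hml => (Finset.mem_erase.1 hm).1 ?_,
        hfal m (Finset.mem_erase.1 hm).2⟩
      rw [← negLit_negLit m, hml, negLit_negLit]
    obtain ⟨ρ₁, hρ₁, hfal₁, hcard⟩ := h.exists_small h2 hfal'
    have hres : (unfalsified τ (C.erase l)).card ≤ K :=
      (Finset.card_le_card ((Finset.filter_subset _ _).trans (Finset.erase_subset _ _))).trans
        (hF C hC)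
    refine h.ax _ (hans ρ₁ hρ₁ (by omega)) C hC fun m hm => ?_
    by_cases hml : m = l
    · rw [hml]
      exact Finset.mem_insert_self _ _
    · exact Finset.mem_insert_of_mem (hfal₁ m (Finset.mem_erase.2 ⟨hml, hm⟩))

end IsStrategy

/-- The lines of a derivation that `τ` does not satisfy and of which it leaves more than `D`
literals unfalsified. -/
def fatLines {s : ℕ} (L : Fin s → BoolClause ν) (D : ℕ) (τ : Finset (ν × Bool)) :
    Finset (Fin s) :=
  Finset.univ.filter fun i => Disjoint (L i) τ ∧ D < (unfalsified τ (L i)).card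

lemma unfalsified_anti {τ τ' : Finset (ν × Bool)} (h : τ ⊆ τ') (C : BoolClause ν) :
    unfalsified τ' C ⊆ unfalsified τ C :=
  Finset.monotone_filter_right C fun _ _ hl hl' => hl (h hl')

lemma fatLines_anti {s : ℕ} (L : Fin s → BoolClause ν) (D : ℕ) {τ τ' : Finset (ν × Bool)}
    (h : τ ⊆ τ') : fatLines L D τ' ⊆ fatLines L D τ := by
  intro i hi
  simp only [fatLines, Finset.mem_filter, Finset.mem_univ, true_and] at hi ⊢
  exact ⟨hi.1.mono_right h, hi.2.trans_le (Finset.card_le_card (unfalsified_anti h _))⟩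

variable [Fintype ν]

/-- Some unassigned literal occurs in a `D / 2N` fraction of the fat lines, where `N` is the number
of variables. -/
lemma exists_popular_literal {s : ℕ} (L : Fin s → BoolClause ν) (D : ℕ)
    (τ : Finset (ν × Bool)) (hne : (fatLines L D τ).Nonempty) :
    ∃ l, l ∉ τ ∧ negLit l ∉ τ ∧
      ((fatLines L D (insert l τ)).card : ℝ) ≤
        (1 - D / (2 * Fintype.card ν)) * (fatLines L D τ).card := by
  classical
  set A := fatLines L D τ with hA
  have hmem : ∀ i ∈ A, Disjoint (L i) τ ∧ D < (unfalsified τ (L i)).card := fun i hi =>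
    (Finset.mem_filter.1 hi).2
  let U : Finset (ν × Bool) := Finset.univ.filter fun l => l ∉ τ ∧ negLit l ∉ τ
  let occ : ν × Bool → ℕ := fun l => (A.filter fun i => l ∈ L i).card
  have hsum : ∑ l ∈ U, occ l = ∑ i ∈ A, (U.filter fun l => l ∈ L i).card := by
    simpa [occ, Finset.bipartiteAbove, Finset.bipartiteBelow] using
      Finset.sum_card_bipartiteAbove_eq_sum_card_bipartiteBelow
        (s := U) (t := A) (fun l i => l ∈ L i)
  have hres : ∀ i ∈ A, unfalsified τ (L i) ⊆ U.filter fun l => l ∈ L i := by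
    intro i hi l hl
    obtain ⟨hlC, hlτ⟩ := Finset.mem_filter.1 hl
    simp only [U, Finset.mem_filter, Finset.mem_univ, true_and]
    exact ⟨⟨fun h => Finset.disjoint_left.1 (hmem i hi).1 hlC h, hlτ⟩, hlC⟩
  have hlow : A.card * D ≤ ∑ l ∈ U, occ l := by
    rw [hsum, ← smul_eq_mul]
    exact Finset.card_nsmul_le_sum _ _ _ fun i hi =>
      (hmem i hi).2.le.trans (Finset.card_le_card (hres i hi))
  have hU : U.Nonempty := by
    obtain ⟨i, hi⟩ := hne
    obtain ⟨l, hl⟩ := Finset.card_pos.1 (Nat.zero_lt_of_lt (hmem i hi).2)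
    exact ⟨l, (Finset.mem_filter.1 (hres i hi hl)).1⟩
  have hUcard : U.card ≤ 2 * Fintype.card ν := by
    refine (Finset.card_le_univ U).trans ?_
    simp [mul_comm]
  obtain ⟨l, hlU, hl⟩ := Finset.exists_max_image U occ hU
  have hup : A.card * D ≤ 2 * Fintype.card ν * occ l := by
    refine hlow.trans ((Finset.sum_le_card_nsmul U occ _ hl).trans ?_)
    rw [smul_eq_mul]
    exact Nat.mul_le_mul_right _ hUcard
  obtain ⟨hl1, hl2⟩ := (Finset.mem_filter.1 hlU).2
  refine ⟨l, hl1, hl2, ?_⟩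
  have hsub : fatLines L D (insert l τ) ⊆ A.filter fun i => ¬ l ∈ L i := by
    intro i hi
    refine Finset.mem_filter.2 ⟨fatLines_anti L D (Finset.subset_insert _ _) hi, fun hli => ?_⟩
    exact Finset.disjoint_left.1 (Finset.mem_filter.1 hi).2.1 hli (Finset.mem_insert_self _ _)
  have hcard := Finset.card_le_card hsub
  have hsplit := Finset.card_filter_add_card_filter_not (s := A) fun i => l ∈ L i
  have hN : (0 : ℝ) < 2 * Fintype.card ν := by
    have : 0 < Fintype.card ν := Fintype.card_pos_iff.2 ⟨l.1⟩
    positivity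
  have hup' : (A.card : ℝ) * D ≤ 2 * Fintype.card ν * occ l := by exact_mod_cast hup
  have h1 : (A.card : ℝ) * D / (2 * Fintype.card ν) ≤ occ l := by
    rw [div_le_iff₀ hN]
    linarith
  have h2 : ((fatLines L D (insert l τ)).card : ℝ) + occ l ≤ A.card := by
    have : (fatLines L D (insert l τ)).card + occ l ≤ A.card := by
      simp only [occ]
      omega
    exact_mod_cast this
  calc ((fatLines L D (insert l τ)).card : ℝ) ≤ A.card - occ l := by linarith
    _ ≤ A.card - A.card * D / (2 * Fintype.card ν) := by linarith
    _ = _ := by ring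

/-- The size–width relation of Ben-Sasson and Wigderson, for strategies. Popular literals
are pinned one after the other: a literal that the adversary may concede removes a fixed fraction
of the fat lines at the cost of one unit of memory, the complement of any other literal is pinned
for free. If the derivation is short, the fat lines are gone before the memory is. -/
lemma IsStrategy.one_le_mul_pow {F : Set (BoolClause ν)} {s q D K : ℕ}
    {L : Fin s → BoolClause ν}
    (hL : ∀ i, QueryStep q (F ∪ {C | ∃ j < i, L j = C}) (L i)) (hgoal : ∃ i, L i = ∅)
    (hF : ∀ C ∈ F, C.card ≤ K) (hD : D ≤ 2 * Fintype.card ν) :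
    ∀ (b W : ℕ) (τ : Finset (ν × Bool)) (H : Set (Finset (ν × Bool))),
      IsStrategy F τ W H → D + q + K + b < W →
      1 ≤ ((fatLines L D τ).card : ℝ) * (1 - D / (2 * Fintype.card ν)) ^ b := by
  have hr : (0 : ℝ) ≤ 1 - D / (2 * Fintype.card ν) := by
    have : (D : ℝ) ≤ 2 * Fintype.card ν := by exact_mod_cast hD
    exact sub_nonneg.2 (div_le_one_of_le₀ this (by positivity))
  have hfat : ∀ (W : ℕ) (τ : Finset (ν × Bool)) (H : Set (Finset (ν × Bool))),
      IsStrategy F τ W H → D + q ≤ W → (fatLines L D τ).Nonempty := by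
    intro W τ H h hW
    by_contra hne
    rw [Finset.not_nonempty_iff_eq_empty] at hne
    obtain ⟨i, hi⟩ := hgoal
    refine h.not_falsifies hW hL (fun j ρ hρ hfal => ?_) i τ h.start (by simp [hi, Falsifies])
    by_contra hlt
    have : j ∈ fatLines L D τ := by
      refine Finset.mem_filter.2 ⟨Finset.mem_univ _, ?_, not_le.1 hlt⟩
      rw [Finset.disjoint_left]
      exact fun l hl hlτ => h.cons ρ hρ l (h.sub ρ hρ hlτ) (hfal l hl)
    simp [hne] at this
  intro b
  induction b with
  | zero =>
    intro W τ H h hW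
    simpa using hfat W τ H h (by omega)
  | succ b ih =>
    intro W τ H
    -- Free pinnings are counted by the number of literals outside `τ`.
    induction hu : (Finset.univ \ τ).card using Nat.strong_induction_on generalizing τ H with
    | _ u ihu =>
      intro h hW
      obtain ⟨l, hl, hl', hpop⟩ := exists_popular_literal L D τ (hfat W τ H h (by omega))
      by_cases hlH : insert l τ ∈ H
      · obtain ⟨W, rfl⟩ : ∃ W', W = W' + 1 := ⟨W - 1, by omega⟩
        refine (ih W _ _ (h.pin_true hl hlH) (by omega)).trans ?_
        rw [pow_succ', ← mul_assoc]
        refine mul_le_mul_of_nonneg_right ?_ (pow_nonneg hr b)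
        linarith
      · have hlt : (Finset.univ \ insert (negLit l) τ).card < u := by
          rw [← hu]
          refine Finset.card_lt_card ⟨Finset.sdiff_subset_sdiff subset_rfl
            (Finset.subset_insert _ _), fun hsub => ?_⟩
          have := hsub (Finset.mem_sdiff.2 ⟨Finset.mem_univ (negLit l), hl'⟩)
          simp at this
        refine (ihu _ hlt _ _ rfl (h.pin_false hF (by omega) hl' hlH) hW).trans ?_
        refine mul_le_mul_of_nonneg_right ?_ (pow_nonneg hr _)
        exact_mod_cast Finset.card_le_card (fatLines_anti L D (Finset.subset_insert _ _))

/-- A derivation of the empty clause has exponentially many lines if the adversary has a strategy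
against a prover with large memory. -/
lemma IsStrategy.exp_le {F : Set (BoolClause ν)} {s q D K b W : ℕ}
    {L : Fin s → BoolClause ν}
    (hL : ∀ i, QueryStep q (F ∪ {C | ∃ j < i, L j = C}) (L i)) (hgoal : ∃ i, L i = ∅)
    (hF : ∀ C ∈ F, C.card ≤ K) (hD : D ≤ 2 * Fintype.card ν)
    {H : Set (Finset (ν × Bool))} (h : IsStrategy F ∅ W H) (hW : D + q + K + b < W) :
    Real.exp (D * b / (2 * Fintype.card ν)) ≤ s := by
  have h1 := IsStrategy.one_le_mul_pow hL hgoal hF hD b W ∅ H h hW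
  have hs : ((fatLines L D ∅).card : ℝ) ≤ s := by
    exact_mod_cast (Finset.card_le_univ _).trans (by simp)
  have hr : (0 : ℝ) ≤ 1 - D / (2 * Fintype.card ν) := by
    have : (D : ℝ) ≤ 2 * Fintype.card ν := by exact_mod_cast hD
    exact sub_nonneg.2 (div_le_one_of_le₀ this (by positivity))
  have h2 : (1 - (D : ℝ) / (2 * Fintype.card ν)) ^ b ≤
      Real.exp (-(D * b / (2 * Fintype.card ν))) := by
    refine (pow_le_pow_left₀ hr (Real.one_sub_le_exp_neg _) b).trans_eq ?_
    rw [← Real.exp_nat_mul]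
    congr 1
    ring
  have h3 : (1 : ℝ) ≤ s * Real.exp (-(D * b / (2 * Fintype.card ν))) :=
    h1.trans (mul_le_mul hs h2 (pow_nonneg hr b) (by positivity))
  rw [Real.exp_neg, ← div_eq_mul_inv, one_le_div (Real.exp_pos _)] at h3
  exact h3

end SizeWidth

/-! ### Strategies on expanding instances -/

lemma ofReal_le_proofLength {α : Type*} {ax : Set α} {rule : Set α → α → Prop} {goal : α} {x : ℝ}
    (h : ∀ (s : ℕ) (π : Fin s → α), IsDerivation ax rule π → (∃ i, π i = goal) → x ≤ s) :
    ENNReal.ofReal x ≤ (proofLength ax rule goal : ℝ≥0∞) := by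
  have h1 : ((⌈x⌉₊ : ℕ) : ℕ∞) ≤ proofLength ax rule goal :=
    le_iInf₂ fun s ⟨π, hπ, hi⟩ => by exact_mod_cast Nat.ceil_le.2 (h s π hπ hi)
  calc ENNReal.ofReal x ≤ ENNReal.ofReal (⌈x⌉₊ : ℕ) :=
        ENNReal.ofReal_le_ofReal (Nat.le_ceil x)
    _ = (((⌈x⌉₊ : ℕ) : ℕ∞) : ℝ≥0∞) := by simp
    _ ≤ _ := ENat.toENNReal_mono h1

lemma queryStep_of_mem {ν : Type*} {q : ℕ} {S : Set (BoolClause ν)} {E : BoolClause ν}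
    (hE : E ∈ S) : QueryStep q S E :=
  ⟨∅, by simp, fun _ _ hρ _ => ⟨E, hE, hρ⟩⟩

lemma queryStep_of_resolutionRule {ν : Type*} [DecidableEq ν] {S : Set (BoolClause ν)}
    {E : BoolClause ν} (h : ResolutionRule S E) : QueryStep 1 S E := by
  obtain ⟨C, hC, D, hD, v, -, -, rfl⟩ := h
  refine ⟨{v}, by simp, fun ρ _ hρ hv => ?_⟩
  obtain ⟨b, hb⟩ := hv v (Finset.mem_singleton_self v)
  cases b with
  | true =>
    refine ⟨D, hD, fun l hl => ?_⟩
    by_cases hlv : l = (v, false)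
    · rw [hlv]
      exact hb
    · exact hρ l (Finset.mem_union_right _ (Finset.mem_erase.2 ⟨hlv, hl⟩))
  | false =>
    refine ⟨C, hC, fun l hl => ?_⟩
    by_cases hlv : l = (v, true)
    · rw [hlv]
      exact hb
    · exact hρ l (Finset.mem_union_left _ (Finset.mem_erase.2 ⟨hlv, hl⟩))

/-- A step of nogood resolution on `x` asks for the truth values of all assignments `x = a`. -/
lemma queryStep_of_nogoodRule {n d : ℕ} {T : Set (Finset (Fin n × Fin d))}
    {M : Finset (Fin n × Fin d)} (h : NogoodRule T M) {S : Set (BoolClause (Fin n × Fin d))}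
    (hT : ∀ N ∈ T, negClause N ∈ S)
    (hdom : ∀ x : Fin n, (Finset.univ.image fun a : Fin d => ((x, a), true)) ∈ S) :
    QueryStep d S (negClause M) := by
  obtain ⟨x, N, hN, rfl⟩ := h
  refine ⟨Finset.univ.image fun a : Fin d => (x, a), Finset.card_image_le.trans (by simp),
    fun ρ _ hρ hv => ?_⟩
  by_cases hx : ∃ a : Fin d, ((x, a), true) ∈ ρ
  · obtain ⟨a, ha⟩ := hx
    refine ⟨_, hT _ (hN a).1, fun l hl => ?_⟩
    obtain ⟨hl1, hl2⟩ := mem_negClause.1 hl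
    by_cases hlv : l.1 = (x, a)
    · simpa [negLit, hl2, hlv] using ha
    · refine hρ l (mem_negClause.2 ⟨?_, hl2⟩)
      exact Finset.mem_biUnion.2 ⟨a, Finset.mem_univ a, Finset.mem_erase.2 ⟨hlv, hl1⟩⟩
  · refine ⟨_, hdom x, fun l hl => ?_⟩
    obtain ⟨a, -, rfl⟩ := Finset.mem_image.1 hl
    obtain ⟨b, hb⟩ := hv (x, a) (Finset.mem_image_of_mem _ (Finset.mem_univ a))
    cases b with
    | true => exact absurd ⟨a, hb⟩ hx
    | false => exact hb

namespace CSPInstance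

variable {n k d : ℕ}

/-- The variables that occur in the clauses of `J`. -/
def vars (J : CSPInstance n k d) : Finset (Fin n) := J.biUnion fun p => Finset.univ.map p.1

/-- The variables that occur in exactly one clause of `J`. -/
def boundary (J : CSPInstance n k d) : Finset (Fin n) :=
  J.vars.filter fun x => (J.filter fun p => x ∈ Finset.univ.map p.1).card = 1

/-- Each set of at most `s` clauses of `I` contains many variables. The factor `(2k + 1) / 4` is
above `k / 2`, which makes the boundary of these sets linear in their size, and below `k - 1`,
which makes sparse random instances expand. -/
def IsExpanding (I : CSPInstance n k d) (s : ℕ) : Prop :=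
  ∀ J ⊆ I, J.card ≤ s → (2 * k + 1) * J.card ≤ 4 * J.vars.card

/-- Variables outside the boundary occur at least twice among the `k * J.card` occurrences. -/
lemma two_mul_card_vars_le (J : CSPInstance n k d) :
    2 * J.vars.card ≤ k * J.card + J.boundary.card := by
  have hsum : ∑ x ∈ J.vars, (J.filter fun p => x ∈ Finset.univ.map p.1).card = k * J.card := by
    have h := Finset.sum_card_bipartiteAbove_eq_sum_card_bipartiteBelow
      (s := J.vars) (t := J) (fun x p => x ∈ Finset.univ.map p.1)
    simp only [Finset.bipartiteAbove, Finset.bipartiteBelow] at h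
    rw [h, Finset.sum_const_nat (m := k), mul_comm]
    intro p hp
    have : (J.vars.filter fun x => x ∈ Finset.univ.map p.1) = Finset.univ.map p.1 := by
      ext x
      simp only [Finset.mem_filter, and_iff_right_iff_imp]
      exact fun hx => Finset.mem_biUnion.2 ⟨p, hp, hx⟩
    rw [this]
    simp
  have hle : ∀ x ∈ J.vars, 2 ≤ (J.filter fun p => x ∈ Finset.univ.map p.1).card +
      if (J.filter fun p => x ∈ Finset.univ.map p.1).card = 1 then 1 else 0 := by
    intro x hx
    obtain ⟨p, hp, hxp⟩ := Finset.mem_biUnion.1 hx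
    have : 0 < (J.filter fun p => x ∈ Finset.univ.map p.1).card :=
      Finset.card_pos.2 ⟨p, Finset.mem_filter.2 ⟨hp, hxp⟩⟩
    split_ifs <;> omega
  have := Finset.card_nsmul_le_sum J.vars _ 2 hle
  rw [Finset.sum_add_distrib, hsum, ← Finset.card_filter] at this
  rw [boundary]
  simpa [mul_comm] using this

lemma IsExpanding.card_le {I : CSPInstance n k d} {s : ℕ} (h : I.IsExpanding s)
    {J : CSPInstance n k d} (hJ : J ⊆ I) (hs : J.card ≤ s) : J.card ≤ 2 * J.boundary.card := by
  have h1 := h J hJ hs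
  have h2 := J.two_mul_card_vars_le
  nlinarith

/-- Some assignment satisfies all clauses of `J` and makes all literals in `ρ` true. -/
def SatWith (J : CSPInstance n k d) (ρ : Finset ((Fin n × Fin d) × Bool)) : Prop :=
  ∃ σ : Fin n → Fin d, (∀ p ∈ J, (fun i => σ (p.1 i)) ∈ p.2) ∧
    ∀ l ∈ ρ, (σ l.1.1 = l.1.2 ↔ l.2 = true)

lemma SatWith.mono {J J' : CSPInstance n k d} {ρ ρ' : Finset ((Fin n × Fin d) × Bool)}
    (h : J.SatWith ρ) (hJ : J' ⊆ J) (hρ : ρ' ⊆ ρ) : J'.SatWith ρ' := by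
  obtain ⟨σ, h1, h2⟩ := h
  exact ⟨σ, fun p hp => h1 p (hJ hp), fun l hl => h2 l (hρ hl)⟩

/-- In a set of clauses that is minimal among those that cannot be satisfied together with `ρ`,
each boundary variable `x` occurs in `ρ`: otherwise one satisfies the other clauses and then, by
unique extendibility, the clause of `x` by changing the value of `x`. -/
lemma card_boundary_le {J : CSPInstance n k d} {ρ : Finset ((Fin n × Fin d) × Bool)}
    (hUE : ∀ p ∈ J, UniquelyExtendible p.2) (hJ : ¬ J.SatWith ρ)
    (hmin : ∀ p ∈ J, SatWith (J.erase p) ρ) : J.boundary.card ≤ ρ.card := by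
  suffices h : J.boundary ⊆ ρ.image fun l => l.1.1 from
    (Finset.card_le_card h).trans Finset.card_image_le
  intro x hx
  by_contra hxρ
  obtain ⟨p, hp⟩ := Finset.card_eq_one.1 (Finset.mem_filter.1 hx).2
  have hpJ : p ∈ J ∧ x ∈ Finset.univ.map p.1 :=
    Finset.mem_filter.1 (hp ▸ Finset.mem_singleton_self p)
  obtain ⟨i, -, rfl⟩ := Finset.mem_map.1 hpJ.2
  obtain ⟨σ, hσ, hσρ⟩ := hmin p hpJ.1
  obtain ⟨a, ha, -⟩ := hUE p hpJ.1 i (fun j => σ (p.1 j))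
  refine hJ ⟨Function.update σ (p.1 i) a, fun r hr => ?_, fun l hl => ?_⟩
  · by_cases hrp : r = p
    · subst hrp
      convert ha using 1
      ext j
      by_cases hj : j = i
      · subst hj
        simp
      · rw [Function.update_of_ne hj, Function.update_of_ne (fun h => hj (r.1.injective h))]
    · convert hσ r (Finset.mem_erase.2 ⟨hrp, hr⟩) using 1
      ext j
      rw [Function.update_of_ne]
      intro hj
      apply hrp
      have : r ∈ J.filter fun r => p.1 i ∈ Finset.univ.map r.1 :=
        Finset.mem_filter.2 ⟨hr, Finset.mem_map.2 ⟨j, Finset.mem_univ j, hj⟩⟩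
      rw [hp] at this
      exact Finset.mem_singleton.1 this
  · rw [Function.update_of_ne]
    · exact hσρ l hl
    · exact fun h => hxρ (Finset.mem_image.2 ⟨l, hl, h⟩)

/-- Consistency with all small sets of clauses propagates to larger ones by expansion. -/
lemma IsExpanding.satWith {I : CSPInstance n k d} {s : ℕ} (h : I.IsExpanding s)
    (hUE : ∀ p ∈ I, UniquelyExtendible p.2) {ρ : Finset ((Fin n × Fin d) × Bool)}
    (hρ : ∀ J ⊆ I, J.card ≤ 2 * ρ.card → J.SatWith ρ) :
    ∀ J ⊆ I, J.card ≤ s → J.SatWith ρ := by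
  intro J
  induction J using Finset.strongInduction with
  | H J ih =>
    intro hJ hs
    by_contra hcon
    refine hcon (hρ J hJ ?_)
    have h1 : (boundary J).card ≤ ρ.card :=
      card_boundary_le (fun p hp => hUE p (hJ hp)) hcon fun p hp =>
        ih _ (Finset.erase_ssubset hp) ((Finset.erase_subset _ _).trans hJ)
          ((Finset.card_le_card (Finset.erase_subset _ _)).trans hs)
    have h2 := h.card_le hJ hs
    omega

/-- On an expanding instance the adversary can keep every set of at most `s` clauses satisfiable
together with the answers given so far. -/
lemma IsExpanding.isStrategy {I : CSPInstance n k d} {s W : ℕ} (h : I.IsExpanding (2 * s))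
    (hUE : ∀ p ∈ I, UniquelyExtendible p.2) (hd : 0 < d) (hs : 1 ≤ s) (hW : 2 * W ≤ s) :
    IsStrategy I.cnf ∅ W {ρ | ∀ J ⊆ I, J.card ≤ s → J.SatWith ρ} where
  start J hJ hJs := by
    refine h.satWith hUE (fun J' _ hJ' => ?_) J hJ (by omega)
    have : J' = ∅ := by simpa using hJ'
    subst this
    exact ⟨fun _ => ⟨0, hd⟩, by simp, by simp⟩
  sub ρ _ := Finset.empty_subset ρ
  cons ρ hρ l hl hl' := by
    obtain ⟨σ, -, hσ⟩ := hρ ∅ (Finset.empty_subset I) (by simp)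
    have h1 := hσ l hl
    have h2 := hσ _ hl'
    simp only [negLit] at h2
    rw [h1] at h2
    cases hl2 : l.2 <;> simp [hl2] at h2
  down ρ hρ ρ' _ hsub J hJ hJs := (hρ J hJ hJs).mono subset_rfl hsub
  answer ρ hρ hcard v := by
    simp only [Finset.card_empty, zero_add] at hcard
    by_contra hcon
    simp only [Set.mem_ofPred_eq, not_exists, not_forall] at hcon
    choose J hJ hJs hJu using hcon
    have hU : (J true ∪ J false).card ≤ 2 * s := by
      have := Finset.card_union_le (J true) (J false)
      have := hJs true
      have := hJs false
      omega
    obtain ⟨σ, hσ, hσρ⟩ := h.satWith hUE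
      (fun J' hJ' hJ's => hρ J' hJ' (by omega)) _ (Finset.union_subset (hJ true) (hJ false)) hU
    refine hJu (decide (σ v.1 = v.2)) ⟨σ, fun p hp => hσ p ?_, fun l hl => ?_⟩
    · cases hb : decide (σ v.1 = v.2) <;> rw [hb] at hp
      · exact Finset.mem_union_right _ hp
      · exact Finset.mem_union_left _ hp
    · rcases Finset.mem_insert.1 hl with rfl | hl
      · simp
      · exact hσρ l hl
  ax ρ hρ C hC hfal := by
    rcases hC with ⟨x, rfl⟩ | ⟨x, a, b, hab, rfl⟩ | ⟨p, hp, t, ht, rfl⟩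
    · obtain ⟨σ, -, hσ⟩ := hρ ∅ (Finset.empty_subset I) (by simp)
      have := hσ _ (hfal ((x, σ x), true) (by simp))
      simp [negLit] at this
    · obtain ⟨σ, -, hσ⟩ := hρ ∅ (Finset.empty_subset I) (by simp)
      have h1 := hσ _ (hfal ((x, a), false) (by simp))
      have h2 := hσ _ (hfal ((x, b), false) (by simp))
      simp [negLit] at h1 h2
      exact hab (h1.symm.trans h2)
    · obtain ⟨σ, hσI, hσ⟩ := hρ {p} (Finset.singleton_subset_iff.2 hp) (by simpa using hs)
      have : (fun i => σ (p.1 i)) = t := by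
        ext1 i
        have := hσ _ (hfal ((p.1 i, t i), false) (by simp))
        simpa [negLit] using this
      exact ht (this ▸ hσI p (Finset.mem_singleton_self p))

lemma card_le_of_mem_cnf {I : CSPInstance n k d} {C : BoolClause (Fin n × Fin d)}
    (hC : C ∈ I.cnf) : C.card ≤ k + d + 2 := by
  rcases hC with ⟨x, rfl⟩ | ⟨x, a, b, hab, rfl⟩ | ⟨p, hp, t, ht, rfl⟩
  · refine Finset.card_image_le.trans ?_
    simp
    omega
  · exact Finset.card_le_two.trans (by omega)
  · refine Finset.card_image_le.trans ?_
    simp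
    omega

variable {I : CSPInstance n k d} {s D b : ℕ}

lemma IsExpanding.le_cRes (h : I.IsExpanding (2 * s))
    (hUE : ∀ p ∈ I, UniquelyExtendible p.2) (hd : 0 < d)
    (hs : 2 * (D + b + k + 2 * d + 3) ≤ s) (hD : D ≤ 2 * (n * d)) :
    ENNReal.ofReal (Real.exp (D * b / (2 * (n * d)))) ≤ (I.cRes : ℝ≥0∞) := by
  refine ofReal_le_proofLength fun r π hπ hgoal => ?_
  have hstr := h.isStrategy hUE hd (by omega) hs
  have := hstr.exp_le (L := π) (q := 1) (D := D) (b := b) (K := k + d + 2) ?_ hgoal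
    (fun C hC => card_le_of_mem_cnf hC) (by simpa using hD) (by omega)
  · simpa using this
  · intro i
    rcases hπ i with hi | hi
    · exact queryStep_of_mem (Or.inl hi)
    · obtain ⟨C, hC, E, hE, hres⟩ := hi
      exact queryStep_of_resolutionRule ⟨C, Or.inr hC, E, Or.inr hE, hres⟩

lemma IsExpanding.le_ngRes (h : I.IsExpanding (2 * s))
    (hUE : ∀ p ∈ I, UniquelyExtendible p.2) (hd : 0 < d)
    (hs : 2 * (D + b + k + 2 * d + 3) ≤ s) (hD : D ≤ 2 * (n * d)) :
    ENNReal.ofReal (Real.exp (D * b / (2 * (n * d)))) ≤ (I.ngRes : ℝ≥0∞) := by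
  refine ofReal_le_proofLength fun r π hπ hgoal => ?_
  have hstr := h.isStrategy hUE hd (by omega) hs
  have := hstr.exp_le (L := fun i => negClause (π i)) (q := d) (D := D) (b := b)
    (K := k + d + 2) ?_ (hgoal.imp fun i hi => by simp [hi, negClause])
    (fun C hC => card_le_of_mem_cnf hC) (by simpa using hD) (by omega)
  · simpa using this
  · intro i
    rcases hπ i with hi | hi
    · exact queryStep_of_mem (Or.inl (nogoods_subset_of_cnf_subset subset_rfl hi))
    · refine queryStep_of_nogoodRule hi ?_ fun x => Or.inl (Or.inl ⟨x, rfl⟩)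
      rintro N ⟨j, hj, rfl⟩
      exact Or.inr ⟨j, hj, rfl⟩

end CSPInstance

/-! ### Random instances contain given clauses with small probability -/

section RandomInstance

open Classical in
/-- The uniquely extendible constraints. -/
noncomputable def ueConstraints (k d : ℕ) : Finset (Finset (Fin k → Fin d)) :=
  Finset.univ.filter fun R => UniquelyExtendible R

open Classical in
/-- The clauses with a uniquely extendible constraint on variables in `Y`. -/
noncomputable def ueClauses {n : ℕ} (k d : ℕ) (Y : Finset (Fin n)) : CSPInstance n k d :=
  (Finset.univ.filter fun e : Fin k ↪ Fin n => ∀ i, e i ∈ Y) ×ˢ ueConstraints k d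

/-- The tuples of sum `0` modulo `d` form a uniquely extendible constraint. -/
lemma ueConstraints_nonempty (k : ℕ) {d : ℕ} (hd : 0 < d) : (ueConstraints k d).Nonempty := by
  classical
  have : NeZero d := ⟨hd.ne'⟩
  refine ⟨Finset.univ.filter fun t => ∑ i, t i = 0, Finset.mem_filter.2 ⟨Finset.mem_univ _, ?_⟩⟩
  intro i t
  have h : ∀ a : Fin d, ∑ j, Function.update t i a j = a + ∑ j ∈ Finset.univ \ {i}, t j :=
    fun a => Finset.sum_update_of_mem (Finset.mem_univ i) t a
  refine ⟨-∑ j ∈ Finset.univ \ {i}, t j, ?_, fun a ha => ?_⟩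
  · simp [h]
  · simpa [h, add_eq_zero_iff_eq_neg] using ha

variable {n k d m : ℕ}

lemma mem_ueClauses {Y : Finset (Fin n)} {p : (Fin k ↪ Fin n) × Finset (Fin k → Fin d)} :
    p ∈ ueClauses k d Y ↔ (∀ i, p.1 i ∈ Y) ∧ UniquelyExtendible p.2 := by
  simp [ueClauses, ueConstraints]

lemma card_embedding_le (Y : Finset (Fin n)) [DecidablePred fun e : Fin k ↪ Fin n => ∀ i, e i ∈ Y] :
    (Finset.univ.filter fun e : Fin k ↪ Fin n => ∀ i, e i ∈ Y).card ≤ Y.card ^ k := by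
  calc _ ≤ (Fintype.piFinset fun _ : Fin k => Y).card :=
        Finset.card_le_card_of_injOn (fun e : Fin k ↪ Fin n => ⇑e) (fun e he => by simpa using he)
          fun e _ e' _ h => DFunLike.coe_injective h
    _ = _ := by simp

lemma card_ueClauses_le (Y : Finset (Fin n)) :
    (ueClauses k d Y).card ≤ Y.card ^ k * (ueConstraints k d).card := by
  classical
  rw [ueClauses, Finset.card_product]
  exact Nat.mul_le_mul_right _ (card_embedding_le Y)

lemma card_ueClauses_univ :
    (ueClauses k d (Finset.univ : Finset (Fin n))).card =
      n.descFactorial k * (ueConstraints k d).card := by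
  simp [ueClauses, Fintype.card_embedding_eq]

lemma mem_ueCSP {I : CSPInstance n k d} :
    I ∈ ueCSP n m k d ↔ I.card = m ∧ (∀ p ∈ I, UniquelyExtendible p.2) ∧
      ∀ p ∈ I, ∀ q ∈ I, Set.range p.1 = Set.range q.1 → p = q := by
  simp [ueCSP]

open Classical in
/-- The clauses on `k`-sets of variables that carry no clause of `I`. -/
noncomputable def freeClauses (I : CSPInstance n k d) : CSPInstance n k d :=
  (ueClauses k d Finset.univ).filter fun q => ∀ p ∈ I, Set.range p.1 ≠ Set.range q.1

lemma mem_freeClauses {I : CSPInstance n k d} {q : (Fin k ↪ Fin n) × Finset (Fin k → Fin d)} :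
    q ∈ freeClauses I ↔ UniquelyExtendible q.2 ∧ ∀ p ∈ I, Set.range p.1 ≠ Set.range q.1 := by
  simp [freeClauses, mem_ueClauses]

lemma card_ueClauses_le_card_freeClauses (I : CSPInstance n k d) :
    n.descFactorial k * (ueConstraints k d).card ≤
      (freeClauses I).card + I.card * (k ^ k * (ueConstraints k d).card) := by
  classical
  rw [← card_ueClauses_univ]
  have hsub : ueClauses k d (Finset.univ : Finset (Fin n)) ⊆
      freeClauses I ∪ I.biUnion fun p => ueClauses k d (Finset.univ.map p.1) := by
    intro q hq
    by_cases h : q ∈ freeClauses I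
    · exact Finset.mem_union_left _ h
    · have hUE := (mem_ueClauses.1 hq).2
      rw [mem_freeClauses] at h
      push Not at h
      obtain ⟨p, hp, hpq⟩ := h hUE
      refine Finset.mem_union_right _ (Finset.mem_biUnion.2 ⟨p, hp, mem_ueClauses.2 ⟨?_, hUE⟩⟩)
      intro i
      obtain ⟨j, hj⟩ : q.1 i ∈ Set.range p.1 := hpq ▸ ⟨i, rfl⟩
      exact Finset.mem_map.2 ⟨j, Finset.mem_univ j, hj⟩
  refine (Finset.card_le_card hsub).trans ((Finset.card_union_le _ _).trans
    (Nat.add_le_add_left (Finset.card_biUnion_le_card_mul _ _ _ fun p _ => ?_) _))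
  simpa using card_ueClauses_le (d := d) (Finset.univ.map p.1)

lemma insert_mem_ueCSP {I : CSPInstance n k d} (hI : I ∈ ueCSP n m k d)
    {q : (Fin k ↪ Fin n) × Finset (Fin k → Fin d)} (hq : q ∈ freeClauses I) :
    q ∉ I ∧ insert q I ∈ ueCSP n (m + 1) k d := by
  obtain ⟨hqUE, hqI⟩ := mem_freeClauses.1 hq
  obtain ⟨h1, h2, h3⟩ := mem_ueCSP.1 hI
  have hqn : q ∉ I := fun h => hqI q h rfl
  refine ⟨hqn, mem_ueCSP.2 ⟨by rw [Finset.card_insert_of_notMem hqn, h1], ?_, ?_⟩⟩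
  · intro p hp
    rcases Finset.mem_insert.1 hp with rfl | hp
    · exact hqUE
    · exact h2 p hp
  · intro p hp p' hp' hpp
    rcases Finset.mem_insert.1 hp with h | hp <;> rcases Finset.mem_insert.1 hp' with h' | hp'
    · rw [h, h']
    · exact absurd (h ▸ hpp.symm) (hqI p' hp')
    · exact absurd (h' ▸ hpp) (hqI p hp)
    · exact h3 p hp p' hp' hpp

lemma erase_mem_ueCSP {I : CSPInstance n k d} (hI : I ∈ ueCSP n (m + 1) k d)
    {p : (Fin k ↪ Fin n) × Finset (Fin k → Fin d)} (hp : p ∈ I) :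
    I.erase p ∈ ueCSP n m k d := by
  obtain ⟨h1, h2, h3⟩ := mem_ueCSP.1 hI
  refine mem_ueCSP.2 ⟨by rw [Finset.card_erase_of_mem hp, h1]; rfl, ?_, ?_⟩
  · exact fun q hq => h2 q (Finset.mem_of_mem_erase hq)
  · exact fun q hq q' hq' => h3 q (Finset.mem_of_mem_erase hq) q' (Finset.mem_of_mem_erase hq')

/-- As long as at most half of the `k`-sets can be occupied, instances exist. -/
lemma ueCSP_nonempty (hd : 0 < d) (hkn : k ≤ n) (hm : 2 * (m * k ^ k) ≤ n.descFactorial k) :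
    (ueCSP n m k d).Nonempty := by
  suffices h : ∀ j ≤ m, (ueCSP n j k d).Nonempty from h m le_rfl
  intro j
  induction j with
  | zero => exact fun _ => ⟨∅, mem_ueCSP.2 (by simp)⟩
  | succ j ih =>
    intro hj
    obtain ⟨I, hI⟩ := ih (by omega)
    have hr := (ueConstraints_nonempty k hd).card_pos
    have hpos : 0 < n.descFactorial k := Nat.descFactorial_pos.2 hkn
    have hle : I.card * k ^ k ≤ m * k ^ k :=
      Nat.mul_le_mul_right _ (by rw [(mem_ueCSP.1 hI).1]; omega)
    have h1 := card_ueClauses_le_card_freeClauses I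
    have h2 : I.card * k ^ k * (ueConstraints k d).card <
        n.descFactorial k * (ueConstraints k d).card :=
      Nat.mul_lt_mul_of_pos_right (by omega) hr
    rw [← mul_assoc] at h1
    obtain ⟨q, hq⟩ := Finset.card_pos.1 (show 0 < (freeClauses I).card by omega)
    exact ⟨_, (insert_mem_ueCSP hI hq).2⟩

open Classical in
/-- Exchange argument: in an instance that contains `insert p J`, the clause `p` can be replaced by
any free clause `q`. The result contains `J`, and it determines the instance together with
`q`, which is one of its `m` clauses. -/
lemma card_filter_insert_subset (hm : 2 * (m * k ^ k) ≤ n.descFactorial k)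
    {J : CSPInstance n k d} {p : (Fin k ↪ Fin n) × Finset (Fin k → Fin d)} (hp : p ∉ J) :
    ((ueCSP n m k d).filter fun I => insert p J ⊆ I).card *
        (n.descFactorial k * (ueConstraints k d).card) ≤
      2 * m * ((ueCSP n m k d).filter fun I => J ⊆ I).card := by
  set A := (ueCSP n m k d).filter fun I => insert p J ⊆ I with hA
  set B := (ueCSP n m k d).filter fun I => J ⊆ I with hB
  have hAI : ∀ I ∈ A, I ∈ ueCSP n m k d ∧ p ∈ I ∧ J ⊆ I := fun I hI => by
    obtain ⟨h1, h2⟩ := Finset.mem_filter.1 hI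
    exact ⟨h1, h2 (Finset.mem_insert_self _ _), (Finset.subset_insert _ _).trans h2⟩
  have hinj : (A.sigma fun I => freeClauses I).card ≤ (B.sigma fun I => I).card := by
    refine Finset.card_le_card_of_injOn
      (fun z => (⟨insert z.2 (z.1.erase p), z.2⟩ : Σ _ : CSPInstance n k d, _)) ?_ ?_
    · rintro ⟨I, q⟩ hz
      obtain ⟨hI, hq⟩ := Finset.mem_sigma.1 hz
      obtain ⟨hI, hpI, hJI⟩ := hAI I hI
      dsimp only at hq hI hpI hJI
      obtain ⟨m', rfl⟩ : ∃ m', m = m' + 1 := by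
        have := (mem_ueCSP.1 hI).1
        have := Finset.card_pos.2 ⟨p, hpI⟩
        exact ⟨m - 1, by omega⟩
      have hq' : q ∈ freeClauses (I.erase p) := by
        rw [mem_freeClauses] at hq ⊢
        exact ⟨hq.1, fun r hr => hq.2 r (Finset.mem_of_mem_erase hr)⟩
      refine Finset.mem_sigma.2 ⟨Finset.mem_filter.2
        ⟨(insert_mem_ueCSP (erase_mem_ueCSP hI hpI) hq').2, fun r hr => ?_⟩,
        Finset.mem_insert_self _ _⟩
      exact Finset.mem_insert_of_mem
        (Finset.mem_erase.2 ⟨fun h => hp (h ▸ hr), hJI hr⟩)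
    · rintro ⟨I, q⟩ hz ⟨I', q'⟩ hz' heq
      obtain ⟨hI, hq⟩ := Finset.mem_sigma.1 hz
      obtain ⟨hI', hq'⟩ := Finset.mem_sigma.1 hz'
      dsimp only at hI hq hI' hq' heq
      have hqq : q = q' := by
        have := congrArg (fun z => z.2) heq
        exact this
      subst hqq
      have hII : insert q (I.erase p) = insert q (I'.erase p) := congrArg (fun z => z.1) heq
      have h1 : q ∉ I := fun h => (mem_freeClauses.1 hq).2 q h rfl
      have h2 : q ∉ I' := fun h => (mem_freeClauses.1 hq').2 q h rfl
      have h3 : I.erase p = I'.erase p := by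
        rw [← Finset.erase_insert (fun h => h1 (Finset.mem_of_mem_erase h)), hII,
          Finset.erase_insert (fun h => h2 (Finset.mem_of_mem_erase h))]
      have h4 : I = I' := by
        rw [← Finset.insert_erase (hAI I hI).2.1, h3, Finset.insert_erase (hAI I' hI').2.1]
      subst h4
      rfl
  have hfree : ∀ I ∈ A, n.descFactorial k * (ueConstraints k d).card ≤
      2 * (freeClauses I).card := by
    intro I hI
    have h1 := card_ueClauses_le_card_freeClauses I
    rw [(mem_ueCSP.1 (hAI I hI).1).1, ← mul_assoc] at h1
    have h2 := Nat.mul_le_mul_right (ueConstraints k d).card hm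
    rw [mul_assoc] at h2
    omega
  rw [Finset.card_sigma, Finset.card_sigma] at hinj
  calc A.card * (n.descFactorial k * (ueConstraints k d).card)
      ≤ ∑ I ∈ A, 2 * (freeClauses I).card := by
        rw [← smul_eq_mul]
        exact Finset.card_nsmul_le_sum _ _ _ hfree
    _ ≤ 2 * ∑ I ∈ B, I.card := by
        rw [← Finset.mul_sum]
        exact Nat.mul_le_mul_left _ hinj
    _ = 2 * m * B.card := by
        rw [Finset.sum_const_nat (m := m) fun I hI => (mem_ueCSP.1 (Finset.mem_filter.1 hI).1).1]
        ring

open Classical in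
lemma card_filter_subset_le (hm : 2 * (m * k ^ k) ≤ n.descFactorial k) (J : CSPInstance n k d) :
    ((ueCSP n m k d).filter fun I => J ⊆ I).card *
        (n.descFactorial k * (ueConstraints k d).card) ^ J.card ≤
      (2 * m) ^ J.card * (ueCSP n m k d).card := by
  induction J using Finset.induction_on with
  | empty => simp
  | insert p J hp ih =>
    rw [Finset.card_insert_of_notMem hp, pow_succ', ← mul_assoc]
    calc _ ≤ 2 * m * ((ueCSP n m k d).filter fun I => J ⊆ I).card *
          (n.descFactorial k * (ueConstraints k d).card) ^ J.card :=
          Nat.mul_le_mul_right _ (card_filter_insert_subset hm hp)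
      _ ≤ 2 * m * ((2 * m) ^ J.card * (ueCSP n m k d).card) := by
          rw [mul_assoc]
          exact Nat.mul_le_mul_left _ ih
      _ = _ := by ring

/-! ### Random instances expand -/

open Classical in
/-- The union bound over the set `Y` of variables of a dense set of `t` clauses, and over the
clauses. -/
lemma card_not_isExpanding_le (S : ℕ) (hm : 2 * (m * k ^ k) ≤ n.descFactorial k) (hkn : k ≤ n)
    (hd : 0 < d) :
    (((ueCSP n m k d).filter fun I => ¬ I.IsExpanding S).card : ℝ) ≤
      ∑ t ∈ Finset.Icc 1 S, ∑ v ∈ (Finset.range (k * t + 1)).filter fun v => 4 * v < (2 * k + 1) * t,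
        (n.choose v : ℝ) * (2 * m * v ^ k / n.descFactorial k) ^ t / t.factorial *
          (ueCSP n m k d).card := by
  set r := (ueConstraints k d).card with hr
  have hrpos : (0 : ℝ) < r := by exact_mod_cast (ueConstraints_nonempty k hd).card_pos
  have hnpos : (0 : ℝ) < n.descFactorial k := by exact_mod_cast Nat.descFactorial_pos.2 hkn
  have hsub : ((ueCSP n m k d).filter fun I => ¬ I.IsExpanding S) ⊆
      (Finset.Icc 1 S).biUnion fun t =>
        ((Finset.range (k * t + 1)).filter fun v => 4 * v < (2 * k + 1) * t).biUnion fun v =>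
          (Finset.powersetCard v Finset.univ).biUnion fun Y =>
            (Finset.powersetCard t (ueClauses k d Y)).biUnion fun J =>
              (ueCSP n m k d).filter fun I => J ⊆ I := by
    intro I hI
    obtain ⟨hI, hbad⟩ := Finset.mem_filter.1 hI
    simp only [CSPInstance.IsExpanding, not_forall, not_le] at hbad
    obtain ⟨J, hJI, hJS, hJ⟩ := hbad
    simp only [Finset.mem_biUnion, Finset.mem_powersetCard, Finset.mem_filter, Finset.mem_Icc,
      Finset.mem_range]
    have hJ0 : 1 ≤ J.card := by
      by_contra h0
      have : J.card = 0 := by omega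
      simp [this] at hJ
    refine ⟨J.card, ⟨hJ0, hJS⟩, (CSPInstance.vars J).card, ⟨?_, hJ⟩, CSPInstance.vars J,
      ⟨Finset.subset_univ _, rfl⟩, J, ⟨fun p hp => ?_, rfl⟩, hI, hJI⟩
    · have := Finset.card_biUnion_le_card_mul J (fun p => Finset.univ.map p.1) k
        (fun p _ => by simp)
      rw [mul_comm] at this
      exact Nat.lt_succ_of_le this
    · exact mem_ueClauses.2 ⟨fun i => Finset.mem_biUnion.2 ⟨p, hp,
        Finset.mem_map_of_mem _ (Finset.mem_univ i)⟩, (mem_ueCSP.1 hI).2.1 p (hJI hp)⟩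
  have hJ : ∀ (t : ℕ) (J : CSPInstance n k d), J.card = t →
      (((ueCSP n m k d).filter fun I => J ⊆ I).card : ℝ) ≤
        (2 * m / (n.descFactorial k * r)) ^ t * (ueCSP n m k d).card := by
    rintro t J rfl
    have h := card_filter_subset_le hm J
    rw [div_pow, div_mul_eq_mul_div, le_div_iff₀ (by positivity)]
    exact_mod_cast h
  have hY : ∀ (t v : ℕ) (Y : Finset (Fin n)), Y.card = v →
      ((((Finset.powersetCard t (ueClauses k d Y)).biUnion fun J =>
        (ueCSP n m k d).filter fun I => J ⊆ I).card : ℕ) : ℝ) ≤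
        (2 * m * v ^ k / n.descFactorial k) ^ t / t.factorial * (ueCSP n m k d).card := by
    rintro t v Y rfl
    calc _ ≤ ∑ J ∈ Finset.powersetCard t (ueClauses k d Y),
          (((ueCSP n m k d).filter fun I => J ⊆ I).card : ℝ) := by
          exact_mod_cast Finset.card_biUnion_le
      _ ≤ ((ueClauses k d Y).card.choose t : ℝ) *
          ((2 * m / (n.descFactorial k * r)) ^ t * (ueCSP n m k d).card) := by
          rw [← Finset.card_powersetCard, ← nsmul_eq_mul]
          exact Finset.sum_le_card_nsmul _ _ _ fun J hJ' => hJ t J (Finset.mem_powersetCard.1 hJ').2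
      _ ≤ ((Y.card ^ k * r : ℝ) ^ t / t.factorial) *
          ((2 * m / (n.descFactorial k * r)) ^ t * (ueCSP n m k d).card) := by
          refine mul_le_mul_of_nonneg_right ?_ (by positivity)
          refine (Nat.choose_le_pow_div t _).trans ?_
          have : ((ueClauses k d Y).card : ℝ) ≤ Y.card ^ k * r := by
            exact_mod_cast card_ueClauses_le Y
          gcongr
      _ = _ := by
          rw [show (2 * m * Y.card ^ k / n.descFactorial k : ℝ) =
            (Y.card ^ k * r) * (2 * m / (n.descFactorial k * r)) by field_simp, mul_pow]
          ring
  refine (Nat.cast_le.2 (Finset.card_le_card hsub)).trans ?_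
  refine (Nat.cast_le.2 Finset.card_biUnion_le).trans ?_
  rw [Nat.cast_sum]
  refine Finset.sum_le_sum fun t _ => ?_
  refine (Nat.cast_le.2 Finset.card_biUnion_le).trans ?_
  rw [Nat.cast_sum]
  refine Finset.sum_le_sum fun v _ => ?_
  refine (Nat.cast_le.2 Finset.card_biUnion_le).trans ?_
  rw [Nat.cast_sum]
  refine (Finset.sum_le_card_nsmul _ _ _ fun Y hY' =>
    hY t v Y (Finset.mem_powersetCard.1 hY').2).trans_eq ?_
  rw [Finset.card_powersetCard, Finset.card_univ, Fintype.card_fin, nsmul_eq_mul]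
  ring

end RandomInstance

section Asymptotics

lemma uniformProb_eq {α : Type*} (Ω : Finset α) (P : α → Prop) [DecidablePred P] :
    uniformProb Ω P = ((Ω.filter P).card : ℝ) / (Ω.card : ℝ) := by
  rw [uniformProb]
  congr!

lemma half_pow_le_descFactorial {n k : ℕ} (hkn : 2 * k ≤ n) :
    ((n : ℝ) / 2) ^ k ≤ n.descFactorial k := by
  have h1 : ((n : ℝ) / 2) ≤ ((n + 1 - k : ℕ) : ℝ) := by
    rw [Nat.cast_sub (by omega)]
    have : (2 * k : ℝ) ≤ n := by exact_mod_cast hkn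
    push_cast
    linarith
  calc ((n : ℝ) / 2) ^ k ≤ ((n + 1 - k : ℕ) : ℝ) ^ k := by gcongr
    _ ≤ _ := by exact_mod_cast Nat.pow_sub_le_descFactorial n k

/-- The union bound term for `t` clauses on `v` variables. With `q = v / n`, the choice of the
variables contributes `(e / q) ^ v` and each clause a factor of order `(n / t) * q ^ k`; since
`v < (2k + 1) t / 4` and `q ≤ p ^ 4`, at least `5 t` factors `p` remain, of which `4 t` make up for
`(n / t) ^ t`. -/
lemma union_bound_term_le {k n m t v : ℕ} {c p : ℝ} (hk : 3 ≤ k) (hc : 0 < c) (hkn : 2 * k ≤ n)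
    (hm : (m : ℝ) ≤ c * n) (ht : 1 ≤ t) (hv : 4 * v < (2 * k + 1) * t)
    (hp0 : 0 ≤ p) (hp1 : p ≤ 1) (hp : p ^ 4 = k * t / n) :
    (n.choose v : ℝ) * (2 * m * v ^ k / n.descFactorial k) ^ t / t.factorial ≤
      (Real.exp 1 ^ (k + 1) * 2 ^ (k + 1) * c * k * p) ^ t := by
  have hn : (0 : ℝ) < n := by
    have : 0 < n := by omega
    exact_mod_cast this
  have ht0 : (0 : ℝ) < t := by exact_mod_cast ht
  have hfac : ∀ j : ℕ, (j : ℝ) ^ j / j.factorial ≤ Real.exp 1 ^ j := fun j => by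
    rw [← Real.exp_nat_mul, mul_one]
    exact Real.pow_div_factorial_le_exp _ (Nat.cast_nonneg j) j
  rcases Nat.eq_zero_or_pos v with rfl | hvpos
  · rw [Nat.cast_zero, zero_pow (by omega), mul_zero, zero_div, zero_pow (by omega), mul_zero,
      zero_div]
    positivity
  have hv0 : (0 : ℝ) < v := by exact_mod_cast hvpos
  have hvkt : v ≤ k * t := by nlinarith
  set q : ℝ := v / n with hq
  have hq0 : 0 < q := by positivity
  have hqp : q ≤ p ^ 4 := by
    rw [hp, hq]
    gcongr
    exact_mod_cast hvkt
  have hchoose : (n.choose v : ℝ) ≤ (1 / q) ^ v * Real.exp 1 ^ v := by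
    calc (n.choose v : ℝ) ≤ (n : ℝ) ^ v / v.factorial := Nat.choose_le_pow_div v n
      _ = (1 / q) ^ v * ((v : ℝ) ^ v / v.factorial) := by
          rw [mul_div_assoc', ← mul_pow, hq, one_div_div, div_mul_cancel₀ _ hv0.ne']
      _ ≤ _ := by gcongr; exact hfac v
  have hX : (2 * m * v ^ k / n.descFactorial k : ℝ) ≤ 2 ^ (k + 1) * c * n * q ^ k := by
    calc (2 * m * v ^ k / n.descFactorial k : ℝ) ≤ 2 * (c * n) * v ^ k / (n / 2) ^ k := by
          gcongr
          exact half_pow_le_descFactorial hkn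
      _ = _ := by rw [hq, div_pow, div_pow, pow_succ]; field_simp
  have hclauses : (2 * m * v ^ k / n.descFactorial k : ℝ) ^ t / t.factorial ≤
      (2 ^ (k + 1) * c * (n / t) * q ^ k) ^ t * Real.exp 1 ^ t := by
    calc (2 * m * v ^ k / n.descFactorial k : ℝ) ^ t / t.factorial
        ≤ (2 ^ (k + 1) * c * n * q ^ k) ^ t / t.factorial := by gcongr
      _ = (2 ^ (k + 1) * c * (n / t) * q ^ k) ^ t * ((t : ℝ) ^ t / t.factorial) := by
          rw [mul_div_assoc', ← mul_pow]
          congr 2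
          field_simp
      _ ≤ _ := by gcongr; exact hfac t
  have hqpow : (1 / q) ^ v * (q ^ k) ^ t ≤ (p ^ 5) ^ t := by
    have hsplit : (q ^ k) ^ t = q ^ v * q ^ (k * t - v) := by
      rw [← pow_mul, ← pow_add, Nat.add_sub_cancel' hvkt]
    rw [hsplit, ← mul_assoc, ← mul_pow, one_div_mul_cancel hq0.ne', one_pow, one_mul]
    calc q ^ (k * t - v) ≤ (p ^ 4) ^ (k * t - v) := by gcongr
      _ = p ^ (4 * (k * t - v)) := by rw [pow_mul]
      _ ≤ p ^ (5 * t) := by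
          refine pow_le_pow_of_le_one hp0 hp1 ?_
          have : 3 * t ≤ k * t := Nat.mul_le_mul_right t hk
          have : (2 * k + 1) * t = 2 * (k * t) + t := by ring
          omega
      _ = _ := by rw [pow_mul]
  have hexp : Real.exp 1 ^ v ≤ (Real.exp 1 ^ k) ^ t := by
    rw [← pow_mul]
    exact pow_le_pow_right₀ (Real.one_le_exp zero_le_one) hvkt
  calc (n.choose v : ℝ) * (2 * m * v ^ k / n.descFactorial k) ^ t / t.factorial
      = n.choose v * ((2 * m * v ^ k / n.descFactorial k) ^ t / t.factorial) := by ring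
    _ ≤ ((1 / q) ^ v * Real.exp 1 ^ v) *
          ((2 ^ (k + 1) * c * (n / t) * q ^ k) ^ t * Real.exp 1 ^ t) := by gcongr
    _ = ((1 / q) ^ v * (q ^ k) ^ t) * (Real.exp 1 ^ v * Real.exp 1 ^ t *
          (2 ^ (k + 1) * c * (n / t)) ^ t) := by rw [mul_pow _ (q ^ k)]; ring
    _ ≤ (p ^ 5) ^ t * ((Real.exp 1 ^ k) ^ t * Real.exp 1 ^ t *
          (2 ^ (k + 1) * c * (n / t)) ^ t) := by gcongr
    _ = _ := by
          rw [← mul_pow, ← mul_pow, ← mul_pow]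
          congr 1
          rw [pow_succ p 4, hp, pow_succ (Real.exp 1)]
          field_simp

/-- Sparse random instances expand at some linear scale: the probability that `t` clauses are too
dense is at most `(B (k t / n) ^ (1 / 4)) ^ t`, and the sum over `t ≤ δ n` is dominated by
`t = 1`. -/
lemma exists_tendsto_not_isExpanding {c : ℝ} (hc : 0 < c) {k d : ℕ} (hk : 3 ≤ k) (hd : 0 < d) :
    ∃ δ : ℝ, 0 < δ ∧ ∀ S : ℕ → ℕ, (∀ᶠ n : ℕ in atTop, (S n : ℝ) ≤ δ * n) →
      Tendsto (fun n : ℕ => uniformProb (ueCSP n ⌊c * n⌋₊ k d) fun I => ¬ I.IsExpanding (S n))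
        atTop (𝓝 0) ∧ ∀ᶠ n : ℕ in atTop, (ueCSP n ⌊c * n⌋₊ k d).Nonempty := by
  classical
  set A : ℝ := Real.exp 1 ^ (k + 1) * 2 ^ (k + 1) * c * k with hA
  have hkpos : (0 : ℝ) < k := by
    have : 0 < k := by omega
    exact_mod_cast this
  have hApos : 0 < A := by positivity
  set B : ℝ := 2 ^ k * A with hB
  have hBpos : 0 < B := by positivity
  set y : ℝ := min 1 (1 / (4 * B)) with hy
  have hypos : 0 < y := lt_min one_pos (by positivity)
  have hBy : B * y ≤ 1 / 4 := by
    calc B * y ≤ B * (1 / (4 * B)) := by gcongr; exact min_le_right _ _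
      _ = 1 / 4 := by field_simp
  let P : ℕ → ℕ → ℝ := fun n t => ((k : ℝ) * t / n) ^ (1 / 4 : ℝ)
  refine ⟨y ^ 4 / k, by positivity, fun S hS => ?_⟩
  -- Enough `k`-sets stay free of clauses, as `k ≥ 2`.
  have hfree : ∀ᶠ n : ℕ in atTop, 2 * k ≤ n ∧ 2 * (⌊c * n⌋₊ * k ^ k) ≤ n.descFactorial k := by
    filter_upwards [eventually_ge_atTop (2 * k), eventually_ge_atTop ⌈8 * c * k ^ k⌉₊] with n h1 h2
    refine ⟨h1, ?_⟩
    have hn6 : (6 : ℝ) ≤ n := by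
      have : 6 ≤ n := by omega
      exact_mod_cast this
    have h3 : 8 * c * k ^ k ≤ n := (Nat.le_ceil _).trans (by exact_mod_cast h2)
    have h4 : (⌊c * n⌋₊ : ℝ) ≤ c * n := Nat.floor_le (by positivity)
    have h5 : (2 * (⌊c * n⌋₊ * k ^ k) : ℝ) ≤ n.descFactorial k := by
      calc (2 * (⌊c * n⌋₊ * k ^ k) : ℝ) ≤ 2 * (c * n * k ^ k) := by gcongr
        _ = 8 * c * k ^ k * n / 4 := by ring
        _ ≤ n * n / 4 := by gcongr
        _ = ((n : ℝ) / 2) ^ 2 := by ring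
        _ ≤ ((n : ℝ) / 2) ^ k := pow_le_pow_right₀ (by linarith) (by omega)
        _ ≤ _ := half_pow_le_descFactorial h1
    exact_mod_cast h5
  have hne : ∀ᶠ n : ℕ in atTop, (ueCSP n ⌊c * n⌋₊ k d).Nonempty :=
    hfree.mono fun n hn => ueCSP_nonempty hd (by omega) hn.2
  refine ⟨?_, hne⟩
  have hbound : ∀ᶠ n : ℕ in atTop,
      uniformProb (ueCSP n ⌊c * n⌋₊ k d) (fun I => ¬ I.IsExpanding (S n)) ≤ 4 * B * P n 1 := by
    filter_upwards [hfree, hne, hS] with n hn hΩ hSn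
    have hn0 : (0 : ℝ) < n := by
      have : 0 < n := by omega
      exact_mod_cast this
    have hΩ' : (0 : ℝ) < (ueCSP n ⌊c * n⌋₊ k d).card := by exact_mod_cast hΩ.card_pos
    rw [uniformProb_eq, div_le_iff₀ hΩ']
    refine (card_not_isExpanding_le (S n) hn.2 (by omega) hd).trans ?_
    have hterm : ∀ t ∈ Finset.Icc 1 (S n),
        ∑ v ∈ (Finset.range (k * t + 1)).filter (fun v => 4 * v < (2 * k + 1) * t),
          (n.choose v : ℝ) * (2 * ⌊c * n⌋₊ * v ^ k / n.descFactorial k) ^ t / t.factorial *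
            (ueCSP n ⌊c * n⌋₊ k d).card ≤
          2 * B * P n 1 * (1 / 2) ^ t * (ueCSP n ⌊c * n⌋₊ k d).card := by
      intro t ht
      obtain ⟨ht1, htS⟩ := Finset.mem_Icc.1 ht
      have hP0 : 0 ≤ P n t := Real.rpow_nonneg (by positivity) _
      have hPpow : P n t ^ 4 = k * t / n := by
        rw [← Real.rpow_natCast, ← Real.rpow_mul (by positivity)]
        norm_num
      have hPy : P n t ≤ y := by
        refine le_of_pow_le_pow_left₀ (n := 4) (by norm_num) hypos.le ?_
        rw [hPpow, div_le_iff₀ hn0]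
        have : (t : ℝ) ≤ y ^ 4 / k * n := (Nat.cast_le.2 htS).trans hSn
        calc (k : ℝ) * t ≤ k * (y ^ 4 / k * n) := by gcongr
          _ = y ^ 4 * n := by field_simp
      have hPt : P n t ≤ t * P n 1 := by
        refine le_of_pow_le_pow_left₀ (n := 4) (by norm_num)
          (mul_nonneg (Nat.cast_nonneg t) (Real.rpow_nonneg (by positivity) _)) ?_
        have h1 : P n 1 ^ 4 = k * (1 : ℕ) / n := by
          rw [← Real.rpow_natCast, ← Real.rpow_mul (by positivity)]
          norm_num
        have ht' : (1 : ℝ) ≤ t := by exact_mod_cast ht1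
        rw [hPpow, mul_pow, h1]
        calc (k : ℝ) * t / n = t ^ 1 * (k * (1 : ℕ) / n) := by push_cast; ring
          _ ≤ t ^ 4 * (k * (1 : ℕ) / n) := by
            gcongr
            norm_num
      rw [← Finset.sum_mul]
      refine mul_le_mul_of_nonneg_right ?_ hΩ'.le
      have hcount : (((Finset.range (k * t + 1)).filter
          (fun v => 4 * v < (2 * k + 1) * t)).card : ℝ) ≤ (2 ^ k) ^ t := by
        have h1 : ((Finset.range (k * t + 1)).filter
            (fun v => 4 * v < (2 * k + 1) * t)).card ≤ k * t + 1 :=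
          (Finset.card_filter_le _ _).trans (by simp)
        have h2 : k * t + 1 ≤ (2 ^ k) ^ t := by
          rw [← pow_mul]
          exact Nat.lt_two_pow_self
        exact_mod_cast h1.trans h2
      calc _ ≤ (((Finset.range (k * t + 1)).filter
              (fun v => 4 * v < (2 * k + 1) * t)).card : ℝ) * (A * P n t) ^ t := by
            rw [← nsmul_eq_mul]
            exact Finset.sum_le_card_nsmul _ _ _ fun v hv =>
              union_bound_term_le hk hc hn.1 (Nat.floor_le (by positivity)) ht1
                (Finset.mem_filter.1 hv).2 hP0 (hPy.trans (min_le_left _ _)) hPpow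
        _ ≤ (2 ^ k) ^ t * (A * P n t) ^ t := by gcongr
        _ = (B * P n t) ^ t := by rw [← mul_pow, hB, mul_assoc (2 ^ k)]
        _ = (B * P n t) ^ (t - 1) * (B * P n t) := by
            rw [← pow_succ, Nat.sub_add_cancel ht1]
        _ ≤ (1 / 4) ^ (t - 1) * (B * (t * P n 1)) := by
            have h4 : B * P n t ≤ 1 / 4 := (mul_le_mul_of_nonneg_left hPy hBpos.le).trans hBy
            gcongr
        _ = (B * P n 1) * ((1 / 2) ^ (t - 1) * (t * (1 / 2) ^ (t - 1))) := by
            rw [show (1 / 4 : ℝ) = (1 / 2) * (1 / 2) by norm_num, mul_pow]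
            ring
        _ ≤ (B * P n 1) * ((1 / 2) ^ (t - 1) * 1) := by
            have h5 : (t : ℝ) * (1 / 2) ^ (t - 1) ≤ 1 := by
              rw [one_div, inv_pow, ← div_eq_mul_inv, div_le_one (by positivity)]
              have : t ≤ 2 ^ (t - 1) := by
                have := Nat.lt_two_pow_self (n := t - 1)
                omega
              exact_mod_cast this
            have : 0 ≤ P n 1 := Real.rpow_nonneg (by positivity) _
            gcongr
        _ = 2 * B * P n 1 * (1 / 2) ^ t := by
            obtain ⟨t, rfl⟩ : ∃ t', t = t' + 1 := ⟨t - 1, by omega⟩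
            rw [Nat.add_sub_cancel, pow_succ]
            ring
    refine (Finset.sum_le_sum hterm).trans ?_
    rw [← Finset.sum_mul, ← Finset.mul_sum]
    refine mul_le_mul_of_nonneg_right ?_ hΩ'.le
    have hgeom : ∑ t ∈ Finset.Icc 1 (S n), (1 / 2 : ℝ) ^ t ≤ 2 := by
      refine (summable_geometric_two.sum_le_tsum _ fun _ _ => by positivity).trans_eq ?_
      exact tsum_geometric_two
    have : 0 ≤ P n 1 := Real.rpow_nonneg (by positivity) _
    calc 2 * B * P n 1 * ∑ t ∈ Finset.Icc 1 (S n), (1 / 2 : ℝ) ^ t ≤ 2 * B * P n 1 * 2 := by gcongr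
      _ = _ := by ring
  have hlim : Tendsto (fun n : ℕ => 4 * B * P n 1) atTop (𝓝 0) := by
    have h1 : Tendsto (fun n : ℕ => (k : ℝ) * (1 : ℕ) / n) atTop (𝓝 0) :=
      tendsto_const_div_atTop_nhds_zero_nat _
    have h2 := h1.rpow_const (p := (1 / 4 : ℝ)) (Or.inr (by norm_num))
    rw [Real.zero_rpow (by norm_num)] at h2
    simpa only [P, mul_zero] using h2.const_mul (4 * B)
  refine tendsto_of_tendsto_of_tendsto_of_le_of_le' tendsto_const_nhds hlim ?_ hbound
  exact Eventually.of_forall fun n => div_nonneg (Nat.cast_nonneg _) (Nat.cast_nonneg _)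

/-! ### Exponential complexity -/

lemma tendsto_uniformProb_of_compl {α : ℕ → Type*} {Ω : ∀ n, Finset (α n)}
    {P Q : ∀ n, α n → Prop} (hΩ : ∀ᶠ n in atTop, (Ω n).Nonempty)
    (hQ : Tendsto (fun n => uniformProb (Ω n) fun x => ¬ Q n x) atTop (𝓝 0))
    (h : ∀ᶠ n in atTop, ∀ x ∈ Ω n, Q n x → P n x) :
    Tendsto (fun n => uniformProb (Ω n) (P n)) atTop (𝓝 1) := by
  classical
  have hlim := hQ.const_sub 1
  rw [sub_zero] at hlim
  refine tendsto_of_tendsto_of_tendsto_of_le_of_le' hlim tendsto_const_nhds ?_ ?_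
  · filter_upwards [hΩ, h] with n hn hPQ
    have hpos : (0 : ℝ) < (Ω n).card := by exact_mod_cast hn.card_pos
    have hsub : Ω n ⊆ ((Ω n).filter fun x => ¬ Q n x) ∪ (Ω n).filter (P n) := by
      intro x hx
      by_cases hq : Q n x
      · exact Finset.mem_union_right _ (Finset.mem_filter.2 ⟨hx, hPQ x hx hq⟩)
      · exact Finset.mem_union_left _ (Finset.mem_filter.2 ⟨hx, hq⟩)
    have hcard : ((Ω n).card : ℝ) ≤ ((Ω n).filter fun x => ¬ Q n x).card +
        ((Ω n).filter (P n)).card := by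
      exact_mod_cast (Finset.card_le_card hsub).trans (Finset.card_union_le _ _)
    rw [sub_le_iff_le_add, uniformProb_eq, uniformProb_eq, ← add_div, le_div_iff₀ hpos, one_mul,
      add_comm]
    exact hcard
  · refine Eventually.of_forall fun n => div_le_one_of_le₀ ?_ (Nat.cast_nonneg _)
    exact_mod_cast Finset.card_filter_le _ _

lemma two_rpow_le_ofReal_exp {x y : ℝ} (hx : 0 ≤ x) (hxy : x ≤ y) :
    (2 : ℝ≥0∞) ^ x ≤ ENNReal.ofReal (Real.exp y) := by
  rw [show (2 : ℝ≥0∞) = ENNReal.ofReal 2 by simp,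
    ENNReal.ofReal_rpow_of_pos two_pos]
  refine ENNReal.ofReal_le_ofReal ?_
  calc (2 : ℝ) ^ x ≤ Real.exp 1 ^ x := by
        refine Real.rpow_le_rpow two_pos.le ?_ hx
        have := Real.add_one_le_exp 1
        linarith
    _ = Real.exp x := by rw [← Real.exp_mul, one_mul]
    _ ≤ Real.exp y := Real.exp_le_exp.2 hxy

/-- A measure with a lower bound in terms of expansion and a trivial exponential upper bound is
a.a.s. exponential. -/
lemma isAASExponential_of_bounds {μ : ∀ {n k d : ℕ}, CSPInstance n k d → ℕ∞} {c : ℝ} (hc : 0 < c)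
    {k d : ℕ} (hk : 3 ≤ k) (hd : 0 < d)
    (hlow : ∀ {n s D b : ℕ} {I : CSPInstance n k d}, I.IsExpanding (2 * s) →
      (∀ p ∈ I, UniquelyExtendible p.2) → 2 * (D + b + k + 2 * d + 3) ≤ s → D ≤ 2 * (n * d) →
      ENNReal.ofReal (Real.exp (D * b / (2 * (n * d)))) ≤ (μ I : ℝ≥0∞))
    (hup : ∀ {n : ℕ} {I : CSPInstance n k d}, ¬ I.Satisfiable → μ I ≤ (2 ^ (n * d * 2) : ℕ)) :
    IsAASExponential μ c k d := by
  obtain ⟨δ, hδ, hexp⟩ := exists_tendsto_not_isExpanding hc hk hd (d := d)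
  set γ : ℝ := min 1 (δ / 16) with hγ
  have hγpos : 0 < γ := lt_min one_pos (by positivity)
  have hγ1 : γ ≤ 1 := min_le_left _ _
  have hγδ : 16 * γ ≤ δ := by
    have : γ ≤ δ / 16 := min_le_right _ _
    linarith
  have hdpos : (0 : ℝ) < d := by exact_mod_cast hd
  let D : ℕ → ℕ := fun n => ⌊γ * n⌋₊
  let s : ℕ → ℕ := fun n => 2 * (D n + D n + k + 2 * d + 3)
  have hD : ∀ n, (D n : ℝ) ≤ γ * n := fun n => Nat.floor_le (by positivity)
  have hS : ∀ᶠ n : ℕ in atTop, ((2 * s n : ℕ) : ℝ) ≤ δ * n := by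
    filter_upwards [eventually_ge_atTop ⌈(4 * (k + 2 * d + 3) : ℝ) / (8 * γ)⌉₊] with n hn
    have h1 : (4 * (k + 2 * d + 3) : ℝ) / (8 * γ) ≤ n :=
      (Nat.le_ceil _).trans (by exact_mod_cast hn)
    rw [div_le_iff₀ (by positivity)] at h1
    have h2 := hD n
    have h3 : 16 * γ * n ≤ δ * n := by gcongr
    simp only [s]
    push_cast
    linarith
  obtain ⟨hlim, hne⟩ := hexp (fun n => 2 * s n) hS
  refine ⟨γ ^ 2 / (8 * d), 2 * d, by positivity, by positivity, ?_⟩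
  refine tendsto_uniformProb_of_compl hne hlim ?_
  filter_upwards [eventually_ge_atTop ⌈2 / γ⌉₊, eventually_gt_atTop 0] with n hn hn0 I hI hexpI
  have hn0' : (0 : ℝ) < n := by exact_mod_cast hn0
  refine ⟨?_, fun hsat => ?_⟩
  · refine le_trans ?_ (hlow (D := D n) (b := D n) hexpI (mem_ueCSP.1 hI).2.1 le_rfl ?_)
    · refine two_rpow_le_ofReal_exp (by positivity) ?_
      have h1 : γ * n / 2 ≤ D n := by
        have h2 : 2 / γ ≤ n := (Nat.le_ceil _).trans (by exact_mod_cast hn)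
        rw [div_le_iff₀ hγpos] at h2
        have := (Nat.lt_floor_add_one (γ * n)).le
        simp only [D]
        linarith
      calc γ ^ 2 / (8 * d) * n = (γ * n / 2) * (γ * n / 2) / (2 * (n * d)) := by
            field_simp
            norm_num
        _ ≤ D n * D n / (2 * (n * d)) := by gcongr
    · have h1 : (D n : ℝ) ≤ n := (hD n).trans (by nlinarith)
      have h2 : D n ≤ n := by exact_mod_cast h1
      nlinarith
  · calc (μ I : ℝ≥0∞) ≤ (((2 ^ (n * d * 2) : ℕ) : ℕ∞) : ℝ≥0∞) := ENat.toENNReal_mono (hup hsat)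
      _ = (2 : ℝ≥0∞) ^ (n * d * 2) := by simp
      _ = (2 : ℝ≥0∞) ^ (2 * d * n : ℝ) := by
          rw [← ENNReal.rpow_natCast]
          congr 1
          push_cast
          ring

end Asymptotics

theorem theorem3 (c : ℝ) (hc : 0 < c) (k d : ℕ) (hk : 3 ≤ k) (hd : 2 ≤ d) :
    IsAASExponential (fun I => I.cRes) c k d ∧
      IsAASExponential (fun I => I.ngRes) c k d := by
  have hd0 : 0 < d := by omega
  refine ⟨isAASExponential_of_bounds hc hk hd0 (fun h hUE hs hD => h.le_cRes hUE hd0 hs hD)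
    CSPInstance.cRes_le, isAASExponential_of_bounds hc hk hd0
    (fun h hUE hs hD => h.le_ngRes hUE hd0 hs hD) fun hI => (CSPInstance.ngRes_le hI).trans ?_⟩
  exact_mod_cast Nat.pow_le_pow_right two_pos (Nat.le_mul_of_pos_right _ two_pos)
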